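/- **Conventions.** Let $U\subseteq\mathbb R^n$ be open, with the coordinates $x^i$ of $\mathbb R^n$; metrics, 1-forms and functions are smooth. A Finsler metric $F$ on $U$ is *dually flat on $U$* if $\sum_k [F^2]_{x^ky^l}y^k-2[F^2]_{x^l}=0$ for all $l$, $x\in U$, $y\neq0$. For a Riemannian metric $\bar\alpha=\sqrt{\bar a_{ij}(x)y^iy^j}$ let $G^i_{\bar\alpha}=\frac12\bar\Gamma^i_{jk}y^jy^k$ be its spray coefficients. A 1-form $\bar\beta=\bar b_i(x)y^i$ is *dually related* to $\bar\alpha$ if there are a 1-form $\theta=\theta_i(x)y^i$ and a scalar function $c(x)$ on $U$ with $$G^i_{\bar\alpha}=2\theta y^i+\bar\alpha^2\theta^i,\qquad \bar b_{i|j}=2\theta_i\bar b_j+c\,\bar a_{ij},$$ where $\theta^i=\bar a^{ij}\theta_j$ and $\bar b_{i|j}=\partial_{x^j}\bar b_i-\bar\Gamma^k_{ij}\bar b_k$ is the covariant derivative with respect to $\bar\alpha$. **Theorem 1.2.** Let $n\ge3$, let $U\subseteq\mathbb R^n$ be open, and let $k_1,k_2,k_3\in\mathbb R$, $\Delta_1:=k_2^2+4k_3$.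 Let $\phi$ be a positive smooth function on a symmetric open interval $(-b_o,b_o)$, $0<b_o\le\infty$, with $\phi'(0)\ne0$ and $$s(k_2-k_3s^2)(\phi\phi'-s\phi'^2-s\phi\phi'')-(\phi'^2+\phi\phi'')+k_1\phi(\phi-s\phi')=0 .$$ Let $\alpha=\sqrt{a_{ij}(x)y^iy^j}$ be a Riemannian metric and $\beta=b_i(x)y^i$ a 1-form on $U$ with $\beta/\alpha\in(-b_o,b_o)$ for all $y\ne0$, such that $F=\alpha\phi(\beta/\alpha)$ is a Finsler metric on $U$ that is not Riemannian on any connected component of $U$. Let $b:=\|\beta\|_\alpha$ and suppose that $1+k_2b^2-k_3b^4>0$ on $U$ and, if $k_3\neq0$ and $\Delta_1=0$, also $2+k_2b^2>0$ on $U$. Then $F$ is dually flat on $U$ if and only if there are a dually flat Riemannian metric $\bar\alpha$ on $U$ and a 1-form $\bar\beta$ on $U$ dually related to $\bar\alpha$ such that, with $\bar b:=\|\bar\beta\|_{\bar\alpha}$, one has $1+k_2\bar b^2-k_3\bar b^4>0$ (and $2+k_2\bar b^2>0$ if $k_3\ne0$, $\Delta_1=0$) and $$\alpha=\eta(\bar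 b^2)\sqrt{\bar\alpha^2-\frac{k_2-k_3\bar b^2}{1+k_2\bar b^2-k_3\bar b^4}\,\bar\beta^2},\qquad \beta=-\frac{\eta(\bar b^2)}{(1+k_2\bar b^2-k_3\bar b^4)^{1/2}}\,\bar\beta .$$ Here $\eta$ is given as follows. 1. If $k_3=0$, $k_2=0$: $\ \eta(\bar b^2)=\exp\{k_1\bar b^2/4\}$. 2. If $k_3=0$, $k_2\ne0$: $\ \eta(\bar b^2)=(1+k_2\bar b^2)^{\frac{k_1-k_2}{4k_2}}$. 3. If $k_3\ne0$, $\Delta_1>0$: $$\eta(\bar b^2)=\frac{\left\{\dfrac{\sqrt{\Delta_1}+k_2}{\sqrt{\Delta_1}-k_2}\cdot\dfrac{\sqrt{\Delta_1}-k_2+2k_3\bar b^2}{\sqrt{\Delta_1}+k_2-2k_3\bar b^2}\right\}^{\frac{2k_1-k_2}{8\sqrt{\Delta_1}}}}{\sqrt[8]{1+k_2\bar b^2-k_3\bar b^4}} .$$ 4. If $k_3\ne0$, $\Delta_1=0$: $$\eta(\bar b^2)=\frac{\sqrt[4]{2}\,\exp\left\{\frac{k_2-2k_1}{2k_2}\left[\frac1{2+k_2\bar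 b^2}-\frac12\right]\right\}}{\sqrt[4]{2+k_2\bar b^2}} .$$ 5. If $k_3\ne0$, $\Delta_1<0$: $$\eta(\bar b^2)=\frac{\exp\left\{\frac{2k_1-k_2}{4\sqrt{-\Delta_1}}\left(\arctan\frac{k_2-2k_3\bar b^2}{\sqrt{-\Delta_1}}-\arctan\frac{k_2}{\sqrt{-\Delta_1}}\right)\right\}}{\sqrt[8]{1+k_2\bar b^2-k_3\bar b^4}} .$$ -/

import Mathlib

open scoped ContDiff Matrix

noncomputable section

namespace AlphaBeta

variable {n : ℕ}

/-- The partial derivative `∂f/∂xⁱ` at the point `x` of `ℝⁿ`. -/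
def pd (i : Fin n) (f : (Fin n → ℝ) → ℝ) (x : Fin n → ℝ) : ℝ :=
  fderiv ℝ f x (Pi.single i 1)

/-- `a = (a_ij)` is a smooth Riemannian metric on the open set `U ⊆ ℝⁿ`
(`Matrix.PosDef` contains the symmetry of the matrix). -/
structure IsRiemannianMetricOn (U : Set (Fin n → ℝ))
    (a : (Fin n → ℝ) → Matrix (Fin n) (Fin n) ℝ) : Prop where
  smooth : ∀ i j, ContDiffOn ℝ ∞ (fun x => a x i j) U
  posDef : ∀ x ∈ U, (a x).PosDef

/-- `b = (b_i)` is a smooth 1-form on the open set `U ⊆ ℝⁿ`. -/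
def IsOneFormOn (U : Set (Fin n → ℝ)) (b : (Fin n → ℝ) → Fin n → ℝ) : Prop :=
  ∀ i, ContDiffOn ℝ ∞ (fun x => b x i) U

/-- The length function `α(x, y) = √(a_ij(x) yⁱ yʲ)` of a Riemannian metric. -/
def alpha (a : (Fin n → ℝ) → Matrix (Fin n) (Fin n) ℝ) (x y : Fin n → ℝ) : ℝ :=
  Real.sqrt (y ⬝ᵥ (a x *ᵥ y))

/-- The value `β(x, y) = b_i(x) yⁱ` of a 1-form. -/
def beta (b : (Fin n → ℝ) → Fin n → ℝ) (x y : Fin n → ℝ) : ℝ :=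
  b x ⬝ᵥ y

/-- Raising the index of a covector: `a^{ij}(x) ξ_j`. -/
def raise (a : (Fin n → ℝ) → Matrix (Fin n) (Fin n) ℝ) (x : Fin n → ℝ) (ξ : Fin n → ℝ) :
    Fin n → ℝ :=
  (a x)⁻¹ *ᵥ ξ

/-- The squared norm `‖β‖²_α = a^{ij} b_i b_j` at `x`. -/
def normSq (a : (Fin n → ℝ) → Matrix (Fin n) (Fin n) ℝ) (b : (Fin n → ℝ) → Fin n → ℝ)
    (x : Fin n → ℝ) : ℝ :=
  b x ⬝ᵥ raise a x (b x)

/-- The function `F = α φ(β / α)`; it vanishes at `y = 0`. -/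
def alphaBetaFun (φ : ℝ → ℝ) (a : (Fin n → ℝ) → Matrix (Fin n) (Fin n) ℝ)
    (b : (Fin n → ℝ) → Fin n → ℝ) (x y : Fin n → ℝ) : ℝ :=
  alpha a x y * φ (beta b x y / alpha a x y)

/-- The fundamental tensor `g_ij(x, y) = [F²/2]_{yⁱ yʲ}`. -/
def fundamentalTensor (F : (Fin n → ℝ) → (Fin n → ℝ) → ℝ) (x y : Fin n → ℝ) :
    Matrix (Fin n) (Fin n) ℝ :=
  Matrix.of fun i j => pd i (fun y' => pd j (fun y'' => F x y'' ^ 2 / 2) y') y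

/-- `F` is a Finsler metric on the open set `U ⊆ ℝⁿ` (with `TU = U × ℝⁿ`). -/
structure IsFinslerMetricOn (U : Set (Fin n → ℝ)) (F : (Fin n → ℝ) → (Fin n → ℝ) → ℝ) :
    Prop where
  nonneg : ∀ x ∈ U, ∀ y, 0 ≤ F x y
  continuous : ContinuousOn (fun p : (Fin n → ℝ) × (Fin n → ℝ) => F p.1 p.2) (U ×ˢ Set.univ)
  smooth : ContDiffOn ℝ ∞ (fun p : (Fin n → ℝ) × (Fin n → ℝ) => F p.1 p.2) (U ×ˢ {0}ᶜ)
  homogeneous : ∀ x ∈ U, ∀ y, ∀ r : ℝ, 0 < r → F x (r • y) = r * F x y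
  strongly_convex : ∀ x ∈ U, ∀ y, y ≠ 0 → (fundamentalTensor F x y).PosDef

/-- `F` is (the length function of) a Riemannian metric on the open set `V`. -/
def IsRiemannianOn (V : Set (Fin n → ℝ)) (F : (Fin n → ℝ) → (Fin n → ℝ) → ℝ) : Prop :=
  ∃ g, IsRiemannianMetricOn V g ∧ ∀ x ∈ V, ∀ y, F x y = alpha g x y

/-- `F` is dually flat on `U ⊆ ℝⁿ`, the coordinates of `ℝⁿ` being adapted:
`[F²]_{xᵏ yˡ} yᵏ - 2 [F²]_{xˡ} = 0` on the slit tangent bundle. -/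
def IsDuallyFlatOn (U : Set (Fin n → ℝ)) (F : (Fin n → ℝ) → (Fin n → ℝ) → ℝ) : Prop :=
  ∀ x ∈ U, ∀ y, y ≠ 0 → ∀ l,
    ∑ k, pd l (fun y' => pd k (fun x' => F x' y' ^ 2) x) y * y k
      - 2 * pd l (fun x' => F x' y ^ 2) x = 0

/-- The Christoffel symbols `Γⁱ_jk` of a Riemannian metric. -/
def christoffel (a : (Fin n → ℝ) → Matrix (Fin n) (Fin n) ℝ) (x : Fin n → ℝ)
    (i j k : Fin n) : ℝ :=
  1 / 2 * ∑ m, (a x)⁻¹ i m *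
    (pd j (fun x' => a x' m k) x + pd k (fun x' => a x' m j) x - pd m (fun x' => a x' j k) x)

/-- The spray coefficients `Gⁱ = Γⁱ_jk yʲ yᵏ / 2` of a Riemannian metric. -/
def spray (a : (Fin n → ℝ) → Matrix (Fin n) (Fin n) ℝ) (x y : Fin n → ℝ) (i : Fin n) : ℝ :=
  1 / 2 * ∑ j, ∑ k, christoffel a x i j k * y j * y k

/-- The covariant derivative `b_{i|j} = ∂b_i/∂xʲ - Γᵏ_ij b_k` of a 1-form. -/
def covDeriv (a : (Fin n → ℝ) → Matrix (Fin n) (Fin n) ℝ) (b : (Fin n → ℝ) → Fin n → ℝ)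
    (x : Fin n → ℝ) (i j : Fin n) : ℝ :=
  pd j (fun x' => b x' i) x - ∑ k, christoffel a x k i j * b x k

/-- The 1-form `β = b_i yⁱ` is dually related to the Riemannian metric `α`: for a 1-form `θ` and
a scalar function `c` one has `Gⁱ_α = 2 θ yⁱ + α² θⁱ` and `b_{i|j} = 2 θ_i b_j + c a_ij`. -/
def IsDuallyRelatedOn (U : Set (Fin n → ℝ)) (a : (Fin n → ℝ) → Matrix (Fin n) (Fin n) ℝ)
    (b : (Fin n → ℝ) → Fin n → ℝ) : Prop :=
  ∃ (θ : (Fin n → ℝ) → Fin n → ℝ) (c : (Fin n → ℝ) → ℝ),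
    IsOneFormOn U θ ∧ ContDiffOn ℝ ∞ c U ∧
    (∀ x ∈ U, ∀ y i,
      spray a x y i = 2 * beta θ x y * y i + alpha a x y ^ 2 * raise a x (θ x) i) ∧
    (∀ x ∈ U, ∀ i j, covDeriv a b x i j = 2 * θ x i * b x j + c x * a x i j)

/-- `I` is an open interval `(-b₀, b₀)` with `0 < b₀ ≤ ∞`. -/
structure IsSymmetricOpenInterval (I : Set ℝ) : Prop where
  isOpen : IsOpen I
  ordConnected : I.OrdConnected
  zero_mem : (0 : ℝ) ∈ I
  neg_mem : ∀ s ∈ I, -s ∈ I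

/-- The three-parameter equation
`s(k₂ - k₃s²)(φφ' - sφ'² - sφφ'') - (φ'² + φφ'') + k₁φ(φ - sφ') = 0` at every `s ∈ I`. -/
def SolvesODE (k₁ k₂ k₃ : ℝ) (I : Set ℝ) (φ : ℝ → ℝ) : Prop :=
  ∀ s ∈ I,
    s * (k₂ - k₃ * s ^ 2) *
        (φ s * deriv φ s - s * deriv φ s ^ 2 - s * φ s * deriv (deriv φ) s)
      - (deriv φ s ^ 2 + φ s * deriv (deriv φ) s)
      + k₁ * φ s * (φ s - s * deriv φ s) = 0

/-- `1 + k₂ t - k₃ t²`, to be evaluated at the squared norm `t`. -/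
def deformQ (k₂ k₃ t : ℝ) : ℝ := 1 + k₂ * t - k₃ * t ^ 2

/-- The quantities whose real powers enter the deformation at the squared norm `t` are positive
(`2 + k₂ t` enters only if `k₃ ≠ 0` and `k₂² + 4k₃ = 0`). -/
def Admissible (k₂ k₃ t : ℝ) : Prop :=
  0 < deformQ k₂ k₃ t ∧ (k₃ ≠ 0 → k₂ ^ 2 + 4 * k₃ = 0 → 0 < 2 + k₂ * t)

open Classical in
/-- The deformation factor `η(t)`, `t` being the squared norm. -/
def eta (k₁ k₂ k₃ t : ℝ) : ℝ :=
  let Δ := k₂ ^ 2 + 4 * k₃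
  let r := Real.sqrt Δ
  let p := Real.sqrt (-Δ)
  if k₃ = 0 then
    if k₂ = 0 then Real.exp (k₁ * t / 4)
    else (1 + k₂ * t) ^ ((k₁ - k₂) / (4 * k₂))
  else if 0 < Δ then
    ((r + k₂) / (r - k₂) * ((r - k₂ + 2 * k₃ * t) / (r + k₂ - 2 * k₃ * t)))
        ^ ((2 * k₁ - k₂) / (8 * r))
      / (deformQ k₂ k₃ t) ^ (1 / 8 : ℝ)
  else if Δ = 0 then
    (2 : ℝ) ^ (1 / 4 : ℝ) * Real.exp ((k₂ - 2 * k₁) / (2 * k₂) * (1 / (2 + k₂ * t) - 1 / 2))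
      / (2 + k₂ * t) ^ (1 / 4 : ℝ)
  else
    Real.exp ((2 * k₁ - k₂) / (4 * p) *
        (Real.arctan ((k₂ - 2 * k₃ * t) / p) - Real.arctan (k₂ / p)))
      / (deformQ k₂ k₃ t) ^ (1 / 8 : ℝ)

/-- `α` and `β` are expressed on `U` through `ᾱ` and `β̄` by
`α = η √(ᾱ² - (k₂ - k₃ b̄²) / (1 + k₂ b̄² - k₃ b̄⁴) β̄²)` and
`β = - η / √(1 + k₂ b̄² - k₃ b̄⁴) β̄`, with `η = η(b̄²)`, where these expressions make sense. -/
def IsDeformationOn (k₁ k₂ k₃ : ℝ) (U : Set (Fin n → ℝ))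
    (a : (Fin n → ℝ) → Matrix (Fin n) (Fin n) ℝ) (b : (Fin n → ℝ) → Fin n → ℝ)
    (a' : (Fin n → ℝ) → Matrix (Fin n) (Fin n) ℝ) (b' : (Fin n → ℝ) → Fin n → ℝ) : Prop :=
  ∀ x ∈ U, Admissible k₂ k₃ (normSq a' b' x) ∧ ∀ y,
    alpha a x y = eta k₁ k₂ k₃ (normSq a' b' x) *
      Real.sqrt (alpha a' x y ^ 2
        - (k₂ - k₃ * normSq a' b' x) / deformQ k₂ k₃ (normSq a' b' x) * beta b' x y ^ 2) ∧
    beta b x y = -(eta k₁ k₂ k₃ (normSq a' b' x)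
        / (deformQ k₂ k₃ (normSq a' b' x)) ^ (1 / 2 : ℝ)) * beta b' x y

end AlphaBeta

end

/-! Both sides are conditions on the first jets of the metric and the form, with `T = ∂a` and `S =
∂b`. The dual flatness expression of `α φ(β/α)` is `flatExpr`. The differential equation for `φ`
leaves only two independent functions of `s = β/α` in it (`flatExpr_eq_add`): the expression becomes
`f(s) · evenPart + g(s) α⁻³ · oddPart`, with `evenPart` even and `oddPart` odd in `y`. Since `φ(0)`
and `φ'(0)` are nonzero, so are `f(0)` and `g(0)`; comparing `y` with `-y` near the hyperplane `β =
0` makes both parts vanish there, hence everywhere because they are polynomials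
(`evenPart_oddPart_eq_zero`). Where `β ≠ 0`, linear algebra solves the two equations: `T` and `S`
are given explicitly by a covector `θ` and a number `m` (`exists_hasFlatJet`), and conversely such
jets annihilate both parts.

Being dually related also prescribes a jet: `isDuallyRelatedOn_iff` puts it in the form
`HasDualJetAt`, where `∂a` is the symmetrisation of `4 θ ⊗ a`. The deformation exchanges the two
kinds of jets. It preserves the squared norm `t` of the form (`IsDeformedOn.normSq_eq`), so it can
be read from either side. A flat jet gives `∂_k t = 4 m Q b_k` with `Q = 1 + k₂ t - k₃ t²`, so the
factor contributes only multiples of `b_k`, and its logarithmic derivative `(k₁ - k₂ + k₃ t) / (4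
Q)` is the one that makes the new `∂a` symmetric (`IsDeformedOn.hasDualJetAt`,
`IsDeformedOn.exists_hasFlatJet`). The explicit formulas for `η` enter only through
`isFactorAt_eta`.

The points with `β = 0` remain, where the linear algebra gives nothing. There `θ` and `c` are
defined as traces of the jets, which are smooth on all of `U`, so the dual relation passes to the
closure of `{β ≠ 0}`. A point outside this closure has a neighbourhood on which `β` vanishes; the
equations for `β`, prolonged by `c`, form a closed linear system, so `β` would vanish on the whole
component (`form_eq_zero_of_hasDualJetAt`) and `F` would be Riemannian there, which is excluded. -/

noncomputable section

namespace AlphaBeta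

/-! ### Pointwise linear algebra: solving the dual flatness equation for the jets -/

section Algebra

variable {V : Type*} [AddCommGroup V] [Module ℝ V]

/-- The coefficient of `φ² - sφφ'` in the equation of dual flatness. -/
def evenPart (k₁ : ℝ) (β : V →ₗ[ℝ] ℝ) (S : V →ₗ[ℝ] V →ₗ[ℝ] ℝ)
    (T : V →ₗ[ℝ] V →ₗ[ℝ] V →ₗ[ℝ] ℝ) (v y : V) : ℝ :=
  2 * (T v y y - T y y v) + 2 * k₁ * (β y * (S v y - 2 * S y v) + β v * S y y)

/-- The coefficient of `(φφ' - sφ'² - sφφ'') / α³` in the equation of dual flatness. -/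
def oddPart (k₂ k₃ : ℝ) (G : V →ₗ[ℝ] V →ₗ[ℝ] ℝ) (β : V →ₗ[ℝ] ℝ) (S : V →ₗ[ℝ] V →ₗ[ℝ] ℝ)
    (T : V →ₗ[ℝ] V →ₗ[ℝ] V →ₗ[ℝ] ℝ) (v y : V) : ℝ :=
  2 * G y y ^ 2 * (S v y - 2 * S y v) + (G y y * β v - β y * G y v) * T y y y
    + 2 * G y y * G y v * S y y
    + 2 * β y * (k₂ * G y y - k₃ * β y ^ 2) * (β y * (S v y - 2 * S y v) + β v * S y y)

theorem eq_zero_of_analytic_of_eventually {f : ℝ → ℝ} (hf : AnalyticOnNhd ℝ f Set.univ)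
    (h : ∀ᶠ r in nhds 0, f r = 0) (r : ℝ) : f r = 0 := by
  have := hf.eqOn_zero_of_preconnected_of_eventuallyEq_zero isPreconnected_univ
    (Set.mem_univ (0 : ℝ)) h
  exact this (Set.mem_univ r)

variable {k₁ k₂ k₃ : ℝ} {G : V →ₗ[ℝ] V →ₗ[ℝ] ℝ} {β : V →ₗ[ℝ] ℝ} {S : V →ₗ[ℝ] V →ₗ[ℝ] ℝ}
  {T : V →ₗ[ℝ] V →ₗ[ℝ] V →ₗ[ℝ] ℝ}

/-- The equations at `y` and `-y` form a 2 × 2 system whose determinant is `f(s) g(-s) + f(-s) g(s)`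
up to sign and a power of `α`. It equals `2 f(0) g(0) ≠ 0` at `s = 0`, so both parts vanish near
`u₀`; along the line from `u₀` to `y` they are polynomials, hence vanish at `y`. -/
theorem evenPart_oddPart_eq_zero (hG : ∀ v, v ≠ 0 → 0 < G v v)
    {u₀ : V} (hu₀ : u₀ ≠ 0) (hβu : β u₀ = 0) {f g : ℝ → ℝ} (hf : ContinuousAt f 0)
    (hg : ContinuousAt g 0) (hf0 : f 0 ≠ 0) (hg0 : g 0 ≠ 0)
    (h : ∀ v y, y ≠ 0 → f (β y / √(G y y)) * evenPart k₁ β S T v y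
      + g (β y / √(G y y)) / (G y y * √(G y y)) * oddPart k₂ k₃ G β S T v y = 0) (v y : V) :
    evenPart k₁ β S T v y = 0 ∧ oddPart k₂ k₃ G β S T v y = 0 := by
  set z := y - u₀ with hz
  have hA0 : 0 < G u₀ u₀ := hG _ hu₀
  have hAc : Continuous fun r : ℝ => G (u₀ + r • z) (u₀ + r • z) := by
    simp only [map_add, map_smul, LinearMap.add_apply, LinearMap.smul_apply, smul_eq_mul]
    fun_prop
  have hBc : Continuous fun r : ℝ => β (u₀ + r • z) := by
    simp only [map_add, map_smul, smul_eq_mul]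
    fun_prop
  have hpos : ∀ᶠ r in nhds (0 : ℝ), 0 < G (u₀ + r • z) (u₀ + r • z) :=
    hAc.continuousAt.eventually_const_lt (by simpa using hA0)
  have hsc : ContinuousAt (fun r : ℝ => β (u₀ + r • z) / √(G (u₀ + r • z) (u₀ + r • z))) 0 := by
    refine hBc.continuousAt.div (hAc.sqrt).continuousAt ?_
    simpa using (Real.sqrt_pos.2 hA0).ne'
  have hs0 : β (u₀ + (0 : ℝ) • z) / √(G (u₀ + (0 : ℝ) • z) (u₀ + (0 : ℝ) • z)) = 0 := by
    simp [hβu]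
  have hdet : ContinuousAt (fun s => f s * g (-s) + f (-s) * g s) 0 := by
    have hn : ContinuousAt (fun s : ℝ => -s) 0 := continuous_neg.continuousAt
    have hf' : ContinuousAt (fun s => f (-s)) 0 :=
      ContinuousAt.comp (g := f) (by simpa using hf) hn
    have hg' : ContinuousAt (fun s => g (-s)) 0 :=
      ContinuousAt.comp (g := g) (by simpa using hg) hn
    exact (hf.mul hg').add (hf'.mul hg)
  have hdet' : ∀ᶠ r in nhds (0 : ℝ),
      (fun s => f s * g (-s) + f (-s) * g s)
        (β (u₀ + r • z) / √(G (u₀ + r • z) (u₀ + r • z))) ≠ 0 := by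
    have hc : ContinuousAt (fun r : ℝ => (fun s => f s * g (-s) + f (-s) * g s)
        (β (u₀ + r • z) / √(G (u₀ + r • z) (u₀ + r • z)))) 0 :=
      ContinuousAt.comp (g := fun s => f s * g (-s) + f (-s) * g s)
        (f := fun r : ℝ => β (u₀ + r • z) / √(G (u₀ + r • z) (u₀ + r • z)))
        (by rw [hs0]; exact hdet) hsc
    refine hc.eventually_ne ?_
    simp only [hs0, neg_zero]
    have := mul_ne_zero hf0 hg0
    intro h0
    apply this
    linarith
  have key : ∀ᶠ r in nhds (0 : ℝ), evenPart k₁ β S T v (u₀ + r • z) = 0 ∧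
      oddPart k₂ k₃ G β S T v (u₀ + r • z) = 0 := by
    filter_upwards [hpos, hdet'] with r hr hd
    set w := u₀ + r • z with hw
    have hw0 : w ≠ 0 := by
      rintro h0
      rw [h0] at hr
      simp at hr
    have h1 := h v w hw0
    have h2 := h v (-w) (neg_ne_zero.2 hw0)
    have he : evenPart k₁ β S T v (-w) = evenPart k₁ β S T v w := by
      simp only [evenPart, map_neg, LinearMap.neg_apply]; ring
    have ho : oddPart k₂ k₃ G β S T v (-w) = - oddPart k₂ k₃ G β S T v w := by
      simp only [oddPart, map_neg, LinearMap.neg_apply]; ring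
    rw [he, ho] at h2
    simp only [map_neg, LinearMap.neg_apply, neg_neg, neg_div] at h2
    set s := β w / √(G w w) with hs
    have hsq : 0 < √(G w w) := Real.sqrt_pos.2 hr
    have hX : evenPart k₁ β S T v w = 0 := by
      refine (mul_eq_zero.1 ?_).resolve_left hd
      linear_combination g (-s) * h1 + g s * h2
    refine ⟨hX, ?_⟩
    have hY : (f s * g (-s) + f (-s) * g s) *
        (oddPart k₂ k₃ G β S T v w / (G w w * √(G w w))) = 0 := by
      linear_combination f (-s) * h1 - f s * h2
    have := (mul_eq_zero.1 hY).resolve_left hd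
    rcases div_eq_zero_iff.1 this with h | h
    · exact h
    · exact absurd h (mul_pos hr hsq).ne'
  have e1 : u₀ + (1 : ℝ) • z = y := by rw [hz]; simp
  have hX := eq_zero_of_analytic_of_eventually (f := fun r => evenPart k₁ β S T v (u₀ + r • z))
    (by
      simp only [evenPart, map_add, map_smul, LinearMap.add_apply, LinearMap.smul_apply,
        smul_eq_mul]
      intro r _
      fun_prop) (key.mono fun r h => h.1) 1
  have hY := eq_zero_of_analytic_of_eventually
    (f := fun r => oddPart k₂ k₃ G β S T v (u₀ + r • z))
    (by
      simp only [oddPart, map_add, map_smul, LinearMap.add_apply, LinearMap.smul_apply,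
        smul_eq_mul]
      intro r _
      fun_prop) (key.mono fun r h => h.2) 1
  simp only [e1] at hX hY
  exact ⟨hX, hY⟩

/-- A bilinear form that vanishes on orthogonal pairs is a multiple of the scalar product. -/
theorem exists_eq_smul_of_orthogonal (hGs : ∀ u v, G u v = G v u)
    (hG : ∀ v, v ≠ 0 → 0 < G v v)
    (h : ∀ u v, β u = 0 → β v = 0 → G u v = 0 → S u v = 0) {u₀ : V} (hu₀ : u₀ ≠ 0)
    (hβu : β u₀ = 0) :
    ∃ m : ℝ, ∀ u v, β u = 0 → β v = 0 → S u v = m * G u v := by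
  -- Apply the hypothesis to `u` and the component of `v` orthogonal to `u`.
  have h1 : ∀ u v, β u = 0 → β v = 0 → u ≠ 0 → S u v * G u u = G u v * S u u := by
    intro u v hu hv hu0
    have hp := hG u hu0
    have := h u (v - (G u v / G u u) • u) hu (by simp [hu, hv])
      (by simp only [map_sub, map_smul, smul_eq_mul]; field_simp; ring)
    simp only [map_sub, map_smul, smul_eq_mul] at this
    field_simp at this
    linear_combination this
  have h2 : ∀ u v, β u = 0 → β v = 0 → u ≠ 0 → S v u * G u u = G u v * S u u := by
    intro u v hu hv hu0
    have hp := hG u hu0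
    have := h (v - (G u v / G u u) • u) u (by simp [hu, hv]) hu
      (by simp only [map_sub, map_smul, smul_eq_mul, LinearMap.sub_apply, LinearMap.smul_apply,
            hGs v u]
          field_simp; ring)
    simp only [map_sub, map_smul, smul_eq_mul, LinearMap.sub_apply, LinearMap.smul_apply] at this
    field_simp at this
    linear_combination this
  have h3 : ∀ u v, β u = 0 → β v = 0 → u ≠ 0 → v ≠ 0 → G u v ≠ 0 →
      S u u / G u u = S v v / G v v := by
    intro u v hu hv hu0 hv0 huv
    have a1 := h1 u v hu hv hu0
    have a2 := h2 v u hv hu hv0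
    have := (hG u hu0).ne'
    have := (hG v hv0).ne'
    rw [hGs v u] at a2
    have e1 : S u u / G u u = S u v / G u v := by field_simp; linear_combination -a1
    have e2 : S v v / G v v = S u v / G u v := by field_simp; linear_combination -a2
    rw [e1, e2]
  -- The ratio `S u u / G u u` agrees on non-orthogonal vectors; orthogonal ones are compared
  -- through `u + u₀`.
  have h4 : ∀ u, β u = 0 → u ≠ 0 → S u u / G u u = S u₀ u₀ / G u₀ u₀ := by
    intro u hu hu0
    by_cases hc : G u u₀ = 0
    · have p1 := hG u hu0
      have p2 := hG u₀ hu₀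
      have hne : u + u₀ ≠ 0 := by
        intro h0
        have : G u (u + u₀) = 0 := by rw [h0]; simp
        rw [map_add, hc] at this
        linarith
      rw [h3 u (u + u₀) hu (by simp [hu, hβu]) hu0 hne (by rw [map_add, hc]; linarith)]
      refine h3 _ _ (by simp [hu, hβu]) hβu hne hu₀ ?_
      rw [map_add, LinearMap.add_apply, hc]; linarith
    · exact h3 _ _ hu hβu hu0 hu₀ hc
  refine ⟨S u₀ u₀ / G u₀ u₀, fun u v hu hv => ?_⟩
  by_cases hu0 : u = 0
  · simp [hu0]
  rw [← h4 u hu hu0]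
  have := (hG u hu0).ne'
  field_simp
  linear_combination h1 u v hu hv hu0

/-- The first jet of `(α, β)` which dual flatness of `α φ(β/α)` forces, up to a covector `θ` and
a number `m`. -/
def HasFlatJet (k₁ k₂ k₃ : ℝ) (G : V →ₗ[ℝ] V →ₗ[ℝ] ℝ) (β : V →ₗ[ℝ] ℝ) (S : V →ₗ[ℝ] V →ₗ[ℝ] ℝ)
    (T : V →ₗ[ℝ] V →ₗ[ℝ] V →ₗ[ℝ] ℝ) (θ : V →ₗ[ℝ] ℝ) (m : ℝ) : Prop :=
  (∀ u v w, T u v w = 4 * (θ u * G v w + θ v * G u w + θ w * G u v)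
      + 2 * m * (k₁ * β w * G u v + 2 * k₃ * β u * β v * β w)) ∧
  (∀ u v, S u v = 4 * θ u * β v + 2 * θ v * β u + m * (2 * G u v + (k₁ + 2 * k₂) * β u * β v))

theorem HasFlatJet.evenPart_eq_zero {θ : V →ₗ[ℝ] ℝ} {m : ℝ} (hGs : ∀ u v, G u v = G v u)
    (h : HasFlatJet k₁ k₂ k₃ G β S T θ m) (v y : V) : evenPart k₁ β S T v y = 0 := by
  simp only [evenPart, h.1, h.2, hGs v y]
  ring

theorem HasFlatJet.oddPart_eq_zero {θ : V →ₗ[ℝ] ℝ} {m : ℝ} (hGs : ∀ u v, G u v = G v u)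
    (h : HasFlatJet k₁ k₂ k₃ G β S T θ m) (v y : V) : oddPart k₂ k₃ G β S T v y = 0 := by
  simp only [oddPart, h.1, h.2, hGs v y]
  ring

theorem exists_hasFlatJet (hGs : ∀ u v, G u v = G v u) (hG : ∀ v, v ≠ 0 → 0 < G v v)
    (hTs : ∀ u v w, T u v w = T v u w) {u₀ e : V} (hu₀ : u₀ ≠ 0) (hβu : β u₀ = 0)
    (he : ∀ v, G e v = β v) (he0 : 0 < β e) (hQ : 0 < deformQ k₂ k₃ (β e))
    (hX : ∀ v y, evenPart k₁ β S T v y = 0) (hY : ∀ v y, oddPart k₂ k₃ G β S T v y = 0) :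
    ∃ θ m, HasFlatJet k₁ k₂ k₃ G β S T θ m := by
  -- On orthogonal pairs in `ker β` only the first term of `oddPart` survives. Exchanging the two
  -- vectors then gives `S v y = 2 S y v = 4 S v y`, so `S` vanishes on such pairs.
  have hc1 : ∀ y v, β y = 0 → β v = 0 → G y v = 0 → S v y = 2 * S y v := by
    intro y v hy hv hyv
    by_cases hy0 : y = 0
    · simp [hy0]
    have := hY v y
    simp only [oddPart, hy, hv, hyv] at this
    have hp := hG y hy0
    have h2 : 2 * G y y ^ 2 * (S v y - 2 * S y v) = 0 := by linear_combination this
    have := (mul_eq_zero.1 h2).resolve_left (by positivity)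
    linarith
  obtain ⟨m', hm'⟩ := exists_eq_smul_of_orthogonal (β := β) (S := S) hGs hG
    (fun u v hu hv huv => by
      have a1 := hc1 u v hu hv huv
      have a2 := hc1 v u hv hu (by rw [hGs, huv])
      linarith) hu₀ hβu
  obtain ⟨m, rfl⟩ : ∃ m, m' = 2 * m := ⟨m' / 2, by ring⟩
  set t := β e with ht
  have hee : G e e = t := he e
  -- At `y = e`, the vector dual to `β`, the coefficient of `T` is zero and the rest has the common
  -- factor `2 t (1 + k₂ t - k₃ t²)`, which is positive.
  have hc2 : ∀ v, t * (S v e - 2 * S e v) + β v * S e e = 0 := by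
    intro v
    have := hY v e
    simp only [oddPart, he, ← ht] at this
    have h2 : (2 * t * deformQ k₂ k₃ t) * (t * (S v e - 2 * S e v) + β v * S e e) = 0 := by
      rw [deformQ]; linear_combination this
    exact (mul_eq_zero.1 h2).resolve_left (by positivity)
  -- The wanted formula for `S` at `(e, e)` fixes the value `θe = θ e`, and at `(e, v)` it then
  -- fixes `θ v`.
  obtain ⟨θe, hθe⟩ : ∃ θe : ℝ, 6 * t * θe = S e e - m * (2 * t + (k₁ + 2 * k₂) * t ^ 2) :=
    ⟨(S e e - m * (2 * t + (k₁ + 2 * k₂) * t ^ 2)) / (6 * t), by field_simp⟩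
  obtain ⟨θ, hθv⟩ : ∃ θ : V →ₗ[ℝ] ℝ, ∀ v,
      2 * t * θ v = S e v - (4 * θe + m * (2 + (k₁ + 2 * k₂) * t)) * β v := by
    refine ⟨(1 / (2 * t)) • (S e - (4 * θe + m * (2 + (k₁ + 2 * k₂) * t)) • β), fun v => ?_⟩
    simp only [LinearMap.smul_apply, LinearMap.sub_apply, smul_eq_mul]
    field_simp
  -- Split both arguments along `e` and `ker β`: `hm'` covers the kernel components, `hθv` the
  -- values `S e v`, and `hc2` converts `S u e` into `S e u`.
  have hS : ∀ u v, S u v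
      = 4 * θ u * β v + 2 * θ v * β u + m * (2 * G u v + (k₁ + 2 * k₂) * β u * β v) := by
    intro u v
    have h1 := hm' (u - (β u / t) • e) (v - (β v / t) • e)
      (by simp only [map_sub, map_smul, smul_eq_mul, ← ht]; field_simp; ring)
      (by simp only [map_sub, map_smul, smul_eq_mul, ← ht]; field_simp; ring)
    simp only [map_sub, map_smul, smul_eq_mul, LinearMap.sub_apply, LinearMap.smul_apply, he,
      hGs u e, ← ht] at h1
    have h2 := hc2 u
    have hu := hθv u
    have hv := hθv v
    have ht2 : t ^ 2 ≠ 0 := by positivity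
    field_simp at h1
    apply mul_left_cancel₀ ht2
    linear_combination h1 + β v * h2 - 2 * t * β v * hu - t * β u * hv
      + 2 * β u * β v * hθe
  -- With `S` known, `oddPart` at `v = e` equals this difference times `t G y y - β(y)²`. That
  -- factor is nonzero near `u₀`, and the identity spreads along lines by analyticity.
  have hcube : ∀ y, T y y y
      - (12 * θ y * G y y + 2 * m * (k₁ * β y * G y y + 2 * k₃ * β y ^ 3)) = 0 := by
    intro y
    set z := y - u₀ with hz
    have e1 : u₀ + (1 : ℝ) • z = y := by rw [hz]; simp
    have := eq_zero_of_analytic_of_eventually (f := fun r => T (u₀ + r • z) (u₀ + r • z) (u₀ + r • z)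
      - (12 * θ (u₀ + r • z) * G (u₀ + r • z) (u₀ + r • z)
        + 2 * m * (k₁ * β (u₀ + r • z) * G (u₀ + r • z) (u₀ + r • z)
        + 2 * k₃ * β (u₀ + r • z) ^ 3)))
      (by
        simp only [map_add, map_smul, LinearMap.add_apply, LinearMap.smul_apply, smul_eq_mul]
        intro r _
        fun_prop) ?_ 1
    · simpa only [e1] using this
    · have hc : Continuous fun r : ℝ =>
          G (u₀ + r • z) (u₀ + r • z) * t - β (u₀ + r • z) ^ 2 := by
        simp only [map_add, map_smul, LinearMap.add_apply, LinearMap.smul_apply, smul_eq_mul]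
        fun_prop
      have hne : ∀ᶠ r in nhds (0 : ℝ),
          G (u₀ + r • z) (u₀ + r • z) * t - β (u₀ + r • z) ^ 2 ≠ 0 := by
        refine hc.continuousAt.eventually_ne ?_
        have := mul_pos (hG u₀ hu₀) he0
        simp only [zero_smul, add_zero, hβu]
        linarith
      filter_upwards [hne] with r hr
      have := hY e (u₀ + r • z)
      simp only [oddPart, hS] at this
      refine (mul_eq_zero.1 ?_).resolve_left hr
      rw [hGs _ e, he, ← ht] at this
      linear_combination this
  -- The cube sees only the symmetrised `T`; `evenPart` supplies the failure of symmetry in the last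
  -- two slots. Two polarisations then recover `T`.
  have hX' : ∀ v y, T y v y = T y y v - k₁ * m * (2 * G y y * β v - 2 * β y * G y v) := by
    intro v y
    have := hX v y
    simp only [evenPart, hS, hGs v y, hTs v y y] at this
    linear_combination this / 2
  have hdiag : ∀ v w, T v v w = 4 * (2 * θ v * G v w + θ w * G v v)
      + 2 * m * (k₁ * β w * G v v + 2 * k₃ * β v ^ 2 * β w) := by
    intro v w
    have a1 := hcube (w + v)
    have a2 := hcube (w - v)
    have a3 := hcube w
    have b1 := hX' w v
    have b2 := hTs w v v
    simp only [map_add, map_sub, LinearMap.add_apply, LinearMap.sub_apply] at a1 a2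
    rw [hGs w v] at a1 a2
    linear_combination a1 / 6 + a2 / 6 - a3 / 3 - (2 / 3) * b1 - (1 / 3) * b2
  refine ⟨θ, m, fun u v w => ?_, hS⟩
  have a1 := hdiag (u + v) w
  have a2 := hdiag (u - v) w
  simp only [map_add, map_sub, LinearMap.add_apply, LinearMap.sub_apply] at a1 a2
  rw [hGs v u] at a1 a2
  have b := hTs v u w
  linear_combination a1 / 4 - a2 / 4 - b / 2

end Algebra

/-! ### The deformation factor and its logarithmic derivative -/

section Eta

variable {k₁ k₂ k₃ t : ℝ}

theorem contDiff_deformQ : ContDiff ℝ ∞ (deformQ k₂ k₃) := by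
  unfold deformQ; fun_prop

theorem hasDerivAt_deformQ : HasDerivAt (deformQ k₂ k₃) (k₂ - 2 * k₃ * t) t := by
  have := (((hasDerivAt_id t).const_mul k₂).const_add 1).sub
    (((hasDerivAt_id t).pow 2).const_mul k₃)
  refine (this.congr_deriv ?_)
  simp; ring

/-- The three properties of the deformation factor which matter: it is positive, smooth, and its
logarithmic derivative is `(k₁ - k₂ + k₃ t) / (4 (1 + k₂ t - k₃ t²))`. -/
def IsFactorAt (k₁ k₂ k₃ : ℝ) (f : ℝ → ℝ) (t : ℝ) : Prop :=
  0 < f t ∧ ContDiffAt ℝ ∞ f t ∧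
    HasDerivAt f (f t * ((k₁ - k₂ + k₃ * t) / (4 * deformQ k₂ k₃ t))) t

/-- Each branch is the exponential of an antiderivative of the same rational function, its shape
depending on how `1 + k₂ t - k₃ t²` factors over the reals. The normalisation at `t = 0` plays no
role here. -/
theorem isFactorAt_eta (h : Admissible k₂ k₃ t) : IsFactorAt k₁ k₂ k₃ (eta k₁ k₂ k₃) t := by
  obtain ⟨hQ, h2⟩ := h
  have hQ' := hQ
  have hQd := hasDerivAt_deformQ (k₂ := k₂) (k₃ := k₃) (t := t)
  have hQc : ContDiffAt ℝ ∞ (deformQ k₂ k₃) t := contDiff_deformQ.contDiffAt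
  unfold deformQ at hQ
  by_cases h3 : k₃ = 0
  · subst h3
    by_cases h20 : k₂ = 0
    · subst h20
      have e : eta k₁ 0 0 = fun t => Real.exp (k₁ * t / 4) := by
        funext t; simp [eta]
      rw [e]
      refine ⟨Real.exp_pos _, by fun_prop, ?_⟩
      have := (((hasDerivAt_id t).const_mul k₁).div_const 4).exp
      refine this.congr_deriv ?_
      simp [deformQ]
    · have e : eta k₁ k₂ 0 = fun t => (1 + k₂ * t) ^ ((k₁ - k₂) / (4 * k₂)) := by
        funext t; simp [eta, h20]
      have hp : 0 < 1 + k₂ * t := by linarith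
      rw [e]
      refine ⟨Real.rpow_pos_of_pos hp _, ?_, ?_⟩
      · exact ContDiffAt.rpow_const_of_ne (by fun_prop) hp.ne'
      · have := (((hasDerivAt_id t).const_mul k₂).const_add 1).rpow_const
          (p := (k₁ - k₂) / (4 * k₂)) (Or.inl (by simpa using hp.ne'))
        refine this.congr_deriv ?_
        simp only [id, deformQ, mul_one, Real.rpow_sub_one hp.ne']
        have : 1 + k₂ * t - 0 * t ^ 2 = 1 + k₂ * t := by ring
        rw [this]
        field_simp
        ring
  by_cases hΔ : 0 < k₂ ^ 2 + 4 * k₃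
  · set r := √(k₂ ^ 2 + 4 * k₃) with hr
    have hr0 : 0 < r := Real.sqrt_pos.2 hΔ
    have hr2 : r ^ 2 = k₂ ^ 2 + 4 * k₃ := Real.sq_sqrt hΔ.le
    have hm : (r - k₂) * (r + k₂) = 4 * k₃ := by linear_combination hr2
    have hm1 : r - k₂ ≠ 0 := fun h0 => h3 (by rw [h0] at hm; linarith)
    have hm2 : r + k₂ ≠ 0 := fun h0 => h3 (by rw [h0] at hm; linarith)
    have hn : (r - k₂ + 2 * k₃ * t) * (r + k₂ - 2 * k₃ * t) = 4 * k₃ * deformQ k₂ k₃ t := by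
      rw [deformQ]; linear_combination hr2
    have hn0 : 4 * k₃ * deformQ k₂ k₃ t ≠ 0 := by
      have := hQ'.ne'
      positivity
    have hn1 : r - k₂ + 2 * k₃ * t ≠ 0 := left_ne_zero_of_mul (hn ▸ hn0)
    have hn2 : r + k₂ - 2 * k₃ * t ≠ 0 := right_ne_zero_of_mul (hn ▸ hn0)
    have e : eta k₁ k₂ k₃ = fun t =>
        ((r + k₂) / (r - k₂) * ((r - k₂ + 2 * k₃ * t) / (r + k₂ - 2 * k₃ * t)))
          ^ ((2 * k₁ - k₂) / (8 * r)) / (deformQ k₂ k₃ t) ^ (1 / 8 : ℝ) := by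
      funext t; simp [eta, h3, hΔ, ← hr]
    -- Since `(r - k₂)(r + k₂) = 4 k₃` and the two linear factors in `t` multiply to `4 k₃ (1 + k₂ t
    -- - k₃ t²)`, the base is `1 + k₂ t - k₃ t²` times a square.
    have hbase : 0 < (r + k₂) / (r - k₂) * ((r - k₂ + 2 * k₃ * t) / (r + k₂ - 2 * k₃ * t)) := by
      have : (r + k₂) / (r - k₂) * ((r - k₂ + 2 * k₃ * t) / (r + k₂ - 2 * k₃ * t))
          = 16 * k₃ ^ 2 * deformQ k₂ k₃ t / ((r - k₂) * (r + k₂ - 2 * k₃ * t)) ^ 2 := by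
        field_simp
        linear_combination (r - k₂ + 2 * k₃ * t) * (r + k₂ - 2 * k₃ * t) * hm + 4 * k₃ * hn
      rw [this]
      positivity
    have hd1 : HasDerivAt (fun t => r - k₂ + 2 * k₃ * t) (2 * k₃) t := by
      simpa using ((hasDerivAt_id t).const_mul (2 * k₃)).const_add (r - k₂)
    have hd2 : HasDerivAt (fun t => r + k₂ - 2 * k₃ * t) (-(2 * k₃)) t := by
      simpa using ((hasDerivAt_id t).const_mul (2 * k₃)).const_sub (r + k₂)
    have hp1 := ((hd1.div hd2 hn2).const_mul ((r + k₂) / (r - k₂))).rpow_const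
      (p := (2 * k₁ - k₂) / (8 * r)) (Or.inl hbase.ne')
    have hp2 := hQd.rpow_const (p := 1 / 8) (Or.inl hQ'.ne')
    have hq : 0 < deformQ k₂ k₃ t ^ (1 / 8 : ℝ) := Real.rpow_pos_of_pos hQ' _
    rw [e]
    refine ⟨div_pos (Real.rpow_pos_of_pos hbase _) hq, ?_, ?_⟩
    · refine ContDiffAt.div (ContDiffAt.rpow_const_of_ne ?_ hbase.ne')
        (hQc.rpow_const_of_ne hQ'.ne') hq.ne'
      exact ContDiffAt.mul (by fun_prop) (ContDiffAt.div (by fun_prop) (by fun_prop) hn2)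
    · refine (hp1.div hp2 hq.ne').congr_deriv ?_
      simp only [Pi.div_apply]
      rw [Real.rpow_sub_one hbase.ne', Real.rpow_sub_one hQ'.ne']
      generalize ((r + k₂) / (r - k₂) * ((r - k₂ + 2 * k₃ * t) / (r + k₂ - 2 * k₃ * t)))
          ^ ((2 * k₁ - k₂) / (8 * r)) = R
      generalize deformQ k₂ k₃ t ^ (1 / 8 : ℝ) = W at hq
      have hQ0 := hQ'.ne'
      have hq0 := hq.ne'
      have key : (2 * k₃ * (r + k₂ - 2 * k₃ * t) - (r - k₂ + 2 * k₃ * t) * -(2 * k₃))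
          / ((r - k₂ + 2 * k₃ * t) * (r + k₂ - 2 * k₃ * t)) = r / deformQ k₂ k₃ t := by
        rw [hn]; field_simp; ring
      have : (r + k₂) / (r - k₂) * ((2 * k₃ * (r + k₂ - 2 * k₃ * t)
          - (r - k₂ + 2 * k₃ * t) * -(2 * k₃)) / (r + k₂ - 2 * k₃ * t) ^ 2)
          = (r + k₂) / (r - k₂) * ((r - k₂ + 2 * k₃ * t) / (r + k₂ - 2 * k₃ * t))
            * (r / deformQ k₂ k₃ t) := by
        rw [← key]; field_simp
      rw [this]
      generalize (r + k₂) / (r - k₂) * ((r - k₂ + 2 * k₃ * t) / (r + k₂ - 2 * k₃ * t)) = N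
        at hbase
      have hN := hbase.ne'
      field_simp
      ring
  by_cases hΔ0 : k₂ ^ 2 + 4 * k₃ = 0
  · have h2t := h2 h3 hΔ0
    have hk2 : k₂ ≠ 0 := by
      rintro rfl
      exact h3 (by linarith)
    have e : eta k₁ k₂ k₃ = fun t => (2 : ℝ) ^ (1 / 4 : ℝ)
        * Real.exp ((k₂ - 2 * k₁) / (2 * k₂) * (1 / (2 + k₂ * t) - 1 / 2))
        / (2 + k₂ * t) ^ (1 / 4 : ℝ) := by
      funext t; simp [eta, h3, hΔ0]
    have hk3 : k₃ = -k₂ ^ 2 / 4 := by linarith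
    -- A double root: positivity of the square leaves the sign of `2 + k₂ t` open, hence the extra
    -- admissibility condition for the fourth root.
    have hQe : deformQ k₂ k₃ t = (2 + k₂ * t) ^ 2 / 4 := by rw [deformQ, hk3]; ring
    have hd : HasDerivAt (fun t => 2 + k₂ * t) k₂ t := by
      simpa using ((hasDerivAt_id t).const_mul k₂).const_add 2
    have hp := hd.rpow_const (p := 1 / 4) (Or.inl h2t.ne')
    have hi := (hd.inv h2t.ne').sub_const (1 / 2)
    have hx := ((hi.const_mul ((k₂ - 2 * k₁) / (2 * k₂))).exp).const_mul ((2 : ℝ) ^ (1 / 4 : ℝ))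
    have hq : 0 < (2 + k₂ * t) ^ (1 / 4 : ℝ) := Real.rpow_pos_of_pos h2t _
    rw [e]
    refine ⟨by positivity, ?_, ?_⟩
    · refine ContDiffAt.div ?_ (ContDiffAt.rpow_const_of_ne (by fun_prop) h2t.ne') hq.ne'
      have : ContDiffAt ℝ ∞ (fun t => 1 / (2 + k₂ * t)) t :=
        ContDiffAt.div (by fun_prop) (by fun_prop) h2t.ne'
      fun_prop
    · simp only [one_div (2 + k₂ * _)]
      refine (hx.div hp hq.ne').congr_deriv ?_
      simp only [Pi.inv_apply]
      rw [Real.rpow_sub_one h2t.ne', hQe, hk3]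
      generalize Real.exp _ = R
      generalize (2 + k₂ * t) ^ (1 / 4 : ℝ) = W at hq
      generalize (2 : ℝ) ^ (1 / 4 : ℝ) = c
      field_simp
      ring
  · have hΔn : 0 < -(k₂ ^ 2 + 4 * k₃) := by
      rcases lt_trichotomy (k₂ ^ 2 + 4 * k₃) 0 with h | h | h
      · linarith
      · exact absurd h hΔ0
      · exact absurd h hΔ
    set p := √(-(k₂ ^ 2 + 4 * k₃)) with hp
    have hp0 : 0 < p := Real.sqrt_pos.2 hΔn
    have hp2 : p ^ 2 = -(k₂ ^ 2 + 4 * k₃) := Real.sq_sqrt hΔn.le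
    have e : eta k₁ k₂ k₃ = fun t => Real.exp ((2 * k₁ - k₂) / (4 * p) *
        (Real.arctan ((k₂ - 2 * k₃ * t) / p) - Real.arctan (k₂ / p)))
        / (deformQ k₂ k₃ t) ^ (1 / 8 : ℝ) := by
      funext t; simp only [eta, h3, hΔ, hΔ0, ← hp, if_false]
    have hd : HasDerivAt (fun t => (k₂ - 2 * k₃ * t) / p) (-(2 * k₃) / p) t := by
      simpa using (((hasDerivAt_id t).const_mul (2 * k₃)).const_sub k₂).div_const p
    have hx := ((hd.arctan.sub_const (Real.arctan (k₂ / p))).const_mul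
      ((2 * k₁ - k₂) / (4 * p))).exp
    have hw := hQd.rpow_const (p := 1 / 8) (Or.inl hQ'.ne')
    have hq : 0 < deformQ k₂ k₃ t ^ (1 / 8 : ℝ) := Real.rpow_pos_of_pos hQ' _
    rw [e]
    refine ⟨div_pos (Real.exp_pos _) hq, ?_, ?_⟩
    · refine ContDiffAt.div ?_ (hQc.rpow_const_of_ne hQ'.ne') hq.ne'
      have : ContDiffAt ℝ ∞ (fun t => Real.arctan ((k₂ - 2 * k₃ * t) / p)) t :=
        ContDiffAt.arctan (by fun_prop)
      fun_prop
    · refine (hx.div hw hq.ne').congr_deriv ?_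
      beta_reduce
      rw [Real.rpow_sub_one hQ'.ne']
      have key : 1 / (1 + ((k₂ - 2 * k₃ * t) / p) ^ 2) * (-(2 * k₃) / p)
          = p / (2 * deformQ k₂ k₃ t) := by
        have h1 : 1 + ((k₂ - 2 * k₃ * t) / p) ^ 2 = -4 * k₃ * deformQ k₂ k₃ t / p ^ 2 := by
          rw [deformQ]; field_simp; linear_combination hp2
        rw [h1]
        have := hQ'.ne'
        field_simp
        ring
      rw [key]
      generalize Real.exp _ = R
      generalize deformQ k₂ k₃ t ^ (1 / 8 : ℝ) = W at hq
      have := hQ'.ne'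
      field_simp
      ring

end Eta

/-! ### Coordinate arrays as multilinear forms; norms and rank-one changes of the metric -/

section Forms

variable {n : ℕ}

/-- The linear form with coefficients `b`. -/
def form1 (b : Fin n → ℝ) : (Fin n → ℝ) →ₗ[ℝ] ℝ := ∑ i, b i • LinearMap.proj i

/-- The bilinear form with coefficients `M`. -/
def form2 (M : Matrix (Fin n) (Fin n) ℝ) : (Fin n → ℝ) →ₗ[ℝ] (Fin n → ℝ) →ₗ[ℝ] ℝ :=
  ∑ i, ∑ j, M i j • (LinearMap.proj i : (Fin n → ℝ) →ₗ[ℝ] ℝ).smulRight (LinearMap.proj j)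

/-- The trilinear form with coefficients `T`. -/
def form3 (T : Fin n → Fin n → Fin n → ℝ) :
    (Fin n → ℝ) →ₗ[ℝ] (Fin n → ℝ) →ₗ[ℝ] (Fin n → ℝ) →ₗ[ℝ] ℝ :=
  ∑ i, ∑ j, ∑ k, T i j k • (LinearMap.proj i : (Fin n → ℝ) →ₗ[ℝ] ℝ).smulRight
    ((LinearMap.proj j : (Fin n → ℝ) →ₗ[ℝ] ℝ).smulRight (LinearMap.proj k))

theorem form1_apply (b u : Fin n → ℝ) : form1 b u = ∑ i, b i * u i := by
  simp [form1, LinearMap.sum_apply]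

theorem form2_apply (M : Matrix (Fin n) (Fin n) ℝ) (u v : Fin n → ℝ) :
    form2 M u v = ∑ i, ∑ j, M i j * (u i * v j) := by
  simp [form2, LinearMap.sum_apply]

theorem form3_apply (T : Fin n → Fin n → Fin n → ℝ) (u v w : Fin n → ℝ) :
    form3 T u v w = ∑ i, ∑ j, ∑ k, T i j k * (u i * (v j * w k)) := by
  simp [form3, LinearMap.sum_apply]

@[simp] theorem form1_single (b : Fin n → ℝ) (i : Fin n) : form1 b (Pi.single i 1) = b i := by
  simp [form1_apply, Pi.single_apply]

@[simp] theorem form2_single (M : Matrix (Fin n) (Fin n) ℝ) (i j : Fin n) :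
    form2 M (Pi.single i 1) (Pi.single j 1) = M i j := by
  simp [form2_apply, Pi.single_apply]

@[simp] theorem form3_single (T : Fin n → Fin n → Fin n → ℝ) (i j k : Fin n) :
    form3 T (Pi.single i 1) (Pi.single j 1) (Pi.single k 1) = T i j k := by
  simp [form3_apply, Pi.single_apply]

theorem form2_comm {M : Matrix (Fin n) (Fin n) ℝ} (h : ∀ i j, M i j = M j i) (u v : Fin n → ℝ) :
    form2 M u v = form2 M v u := by
  rw [form2_apply, form2_apply, Finset.sum_comm]
  refine Finset.sum_congr rfl fun i _ => Finset.sum_congr rfl fun j _ => ?_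
  rw [h j i]; ring

theorem form3_comm {T : Fin n → Fin n → Fin n → ℝ} (h : ∀ i j k, T i j k = T j i k)
    (u v w : Fin n → ℝ) : form3 T u v w = form3 T v u w := by
  rw [form3_apply, form3_apply, Finset.sum_comm]
  refine Finset.sum_congr rfl fun i _ => Finset.sum_congr rfl fun j _ =>
    Finset.sum_congr rfl fun k _ => ?_
  rw [h j i]; ring

theorem linearMap_ext2 {f g : (Fin n → ℝ) →ₗ[ℝ] (Fin n → ℝ) →ₗ[ℝ] ℝ}
    (h : ∀ i j, f (Pi.single i 1) (Pi.single j 1) = g (Pi.single i 1) (Pi.single j 1)) :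
    f = g := by
  refine LinearMap.pi_ext' fun i => LinearMap.ext_ring ?_
  refine LinearMap.pi_ext' fun j => LinearMap.ext_ring ?_
  simpa using h i j

theorem dotProduct_eq_form1 (b u : Fin n → ℝ) : b ⬝ᵥ u = form1 b u := by
  rw [form1_apply]; rfl

theorem dotProduct_mulVec_eq_form2 (M : Matrix (Fin n) (Fin n) ℝ) (u v : Fin n → ℝ) :
    u ⬝ᵥ (M *ᵥ v) = form2 M u v := by
  rw [form2_apply]
  simp only [dotProduct, Matrix.mulVec, Finset.mul_sum]
  refine Finset.sum_congr rfl fun i _ => Finset.sum_congr rfl fun j _ => ?_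
  ring

theorem mulVec_eq_form2 (M : Matrix (Fin n) (Fin n) ℝ) (v : Fin n → ℝ) (i : Fin n) :
    (M *ᵥ v) i = form2 M (Pi.single i 1) v := by
  rw [← dotProduct_mulVec_eq_form2]; simp

theorem beta_eq_form1 (b : (Fin n → ℝ) → Fin n → ℝ) (x y : Fin n → ℝ) :
    beta b x y = form1 (b x) y := dotProduct_eq_form1 _ _

theorem posDef_symm {M : Matrix (Fin n) (Fin n) ℝ} (h : M.PosDef) (i j : Fin n) :
    M i j = M j i := by
  simpa using (h.isHermitian.apply i j).symm

theorem posDef_form2_pos {M : Matrix (Fin n) (Fin n) ℝ} (h : M.PosDef) (v : Fin n → ℝ)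
    (hv : v ≠ 0) : 0 < form2 M v v := by
  have := h.dotProduct_mulVec_pos hv
  rwa [star_trivial, dotProduct_mulVec_eq_form2] at this

theorem posDef_of_form2_pos {M : Matrix (Fin n) (Fin n) ℝ} (hs : ∀ i j, M i j = M j i)
    (h : ∀ v, v ≠ 0 → 0 < form2 M v v) : M.PosDef := by
  refine Matrix.PosDef.of_dotProduct_mulVec_pos ?_ fun v hv => ?_
  · ext i j; simp [hs j i]
  · rw [star_trivial, dotProduct_mulVec_eq_form2]; exact h v hv

theorem alpha_sq {a : (Fin n → ℝ) → Matrix (Fin n) (Fin n) ℝ} {x : Fin n → ℝ}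
    (h : (a x).PosDef) (y : Fin n → ℝ) : alpha a x y ^ 2 = form2 (a x) y y := by
  rw [alpha, Real.sq_sqrt, dotProduct_mulVec_eq_form2]
  simpa using h.posSemidef.dotProduct_mulVec_nonneg y

theorem alpha_eq {a : (Fin n → ℝ) → Matrix (Fin n) (Fin n) ℝ} {x y : Fin n → ℝ} :
    alpha a x y = √(form2 (a x) y y) := by
  rw [alpha, dotProduct_mulVec_eq_form2]

theorem mulVec_raise {a : (Fin n → ℝ) → Matrix (Fin n) (Fin n) ℝ} {x : Fin n → ℝ}
    (h : (a x).PosDef) (ξ : Fin n → ℝ) : a x *ᵥ raise a x ξ = ξ := by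
  rw [raise, Matrix.mulVec_mulVec, Matrix.mul_nonsing_inv _ h.det_pos.ne'.isUnit,
    Matrix.one_mulVec]

theorem raise_eq_of_mulVec {a : (Fin n → ℝ) → Matrix (Fin n) (Fin n) ℝ} {x : Fin n → ℝ}
    (h : (a x).PosDef) {ξ e : Fin n → ℝ} (he : a x *ᵥ e = ξ) : raise a x ξ = e := by
  rw [raise, ← he, Matrix.mulVec_mulVec, Matrix.nonsing_inv_mul _ h.det_pos.ne'.isUnit,
    Matrix.one_mulVec]

theorem form2_raise {a : (Fin n → ℝ) → Matrix (Fin n) (Fin n) ℝ} {x : Fin n → ℝ}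
    (h : (a x).PosDef) (ξ v : Fin n → ℝ) : form2 (a x) v (raise a x ξ) = form1 ξ v := by
  rw [← dotProduct_mulVec_eq_form2, mulVec_raise h, dotProduct_comm, dotProduct_eq_form1]

theorem form2_raise_left {a : (Fin n → ℝ) → Matrix (Fin n) (Fin n) ℝ} {x : Fin n → ℝ}
    (h : (a x).PosDef) (ξ v : Fin n → ℝ) : form2 (a x) (raise a x ξ) v = form1 ξ v := by
  rw [form2_comm (posDef_symm h), form2_raise h]

theorem normSq_eq_form1 {a : (Fin n → ℝ) → Matrix (Fin n) (Fin n) ℝ}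
    {b : (Fin n → ℝ) → Fin n → ℝ} {x : Fin n → ℝ} :
    normSq a b x = form1 (b x) (raise a x (b x)) := dotProduct_eq_form1 _ _

theorem normSq_nonneg {a : (Fin n → ℝ) → Matrix (Fin n) (Fin n) ℝ}
    {b : (Fin n → ℝ) → Fin n → ℝ} {x : Fin n → ℝ} (h : (a x).PosDef) : 0 ≤ normSq a b x := by
  rw [normSq_eq_form1, ← form2_raise h, ← alpha_sq h]
  positivity

theorem normSq_pos {a : (Fin n → ℝ) → Matrix (Fin n) (Fin n) ℝ}
    {b : (Fin n → ℝ) → Fin n → ℝ} {x : Fin n → ℝ} (h : (a x).PosDef) (hb : b x ≠ 0) :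
    0 < normSq a b x := by
  rw [normSq_eq_form1, ← form2_raise h]
  refine posDef_form2_pos h _ fun h0 => hb ?_
  rw [← mulVec_raise h (b x), h0, Matrix.mulVec_zero]

/-- Cauchy–Schwarz, from nonnegativity of the metric on `t y - β(y) e` with `e` dual to `β` and `t`
the squared norm. -/
theorem form1_sq_le {a : (Fin n → ℝ) → Matrix (Fin n) (Fin n) ℝ}
    {b : (Fin n → ℝ) → Fin n → ℝ} {x : Fin n → ℝ} (h : (a x).PosDef) (y : Fin n → ℝ) :
    form1 (b x) y ^ 2 ≤ normSq a b x * form2 (a x) y y := by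
  by_cases hb : b x = 0
  · have : form1 (b x) y = 0 := by simp [hb, form1_apply]
    rw [this]
    have := mul_nonneg (normSq_nonneg (a := a) (b := b) h) (sq_nonneg (alpha a x y))
    rw [alpha_sq h] at this
    simpa using this
  have ht := normSq_pos h hb
  set t := normSq a b x with htd
  have h0 := sq_nonneg (alpha a x (t • y - form1 (b x) y • raise a x (b x)))
  rw [alpha_sq h] at h0
  simp only [map_sub, map_smul, LinearMap.sub_apply, LinearMap.smul_apply, smul_eq_mul,
    form2_raise h, form2_raise_left h, ← normSq_eq_form1, ← htd] at h0
  have : 0 ≤ t * (t * form2 (a x) y y - form1 (b x) y ^ 2) := by linarith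
  have := nonneg_of_mul_nonneg_right this ht
  linarith

/-- The metric `l (a + κ bᵢ bⱼ)` and the `1`-form `μ b` have the squared norm
`μ² t / (l (1 + κ t))`. -/
theorem normSq_rankOne {a a' : (Fin n → ℝ) → Matrix (Fin n) (Fin n) ℝ}
    {b b' : (Fin n → ℝ) → Fin n → ℝ} {x : Fin n → ℝ} {l κ μ : ℝ} (h : (a x).PosDef)
    (h' : (a' x).PosDef) (ha : ∀ i j, a' x i j = l * (a x i j + κ * (b x i * b x j)))
    (hb : ∀ i, b' x i = μ * b x i) (hl : l ≠ 0) (hκ : 1 + κ * normSq a b x ≠ 0) :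
    normSq a' b' x = μ ^ 2 * normSq a b x / (l * (1 + κ * normSq a b x)) := by
  set e := raise a x (b x) with he
  set t := normSq a b x with ht
  -- A rank-one change along `b` maps the vector dual to `b` to a multiple of `b`, so the new dual
  -- vector is a multiple of the old one and no inverse matrix is computed.
  have h1 : a' x *ᵥ ((μ / (l * (1 + κ * t))) • e) = b' x := by
    ext i
    have h2 : (a' x *ᵥ e) i = l * (b x i + κ * b x i * t) := by
      have h3 : (a x *ᵥ e) i = b x i := by rw [he, mulVec_raise h]
      rw [ht, normSq_eq_form1, ← he, form1_apply, ← h3]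
      simp only [Matrix.mulVec, dotProduct, ha]
      rw [mul_add, Finset.mul_sum, Finset.mul_sum, Finset.mul_sum, ← Finset.sum_add_distrib]
      rw [show (∑ j, a x i j * e j) = b x i from h3]
      refine Finset.sum_congr rfl fun j _ => ?_
      ring
    rw [Matrix.mulVec_smul, Pi.smul_apply, h2, hb, smul_eq_mul]
    field_simp
  rw [normSq_eq_form1, raise_eq_of_mulVec h' h1]
  have h4 : form1 (b' x) = μ • form1 (b x) := by
    refine LinearMap.pi_ext' fun i => LinearMap.ext_ring ?_
    simp [hb]
  rw [h4, map_smul, LinearMap.smul_apply, he, ← normSq_eq_form1, ← ht, smul_eq_mul, smul_eq_mul]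
  field_simp

end Forms

/-! ### Rules for partial derivatives -/

section PartialDerivatives

variable {n : ℕ} {f g : (Fin n → ℝ) → ℝ} {x : Fin n → ℝ} {k : Fin n} {U : Set (Fin n → ℝ)}

theorem pd_eq_of_hasFDerivAt {f' : (Fin n → ℝ) →L[ℝ] ℝ} (h : HasFDerivAt f f' x) (k : Fin n) :
    pd k f x = f' (Pi.single k 1) := by
  rw [pd, h.fderiv]

theorem pd_congr (h : f =ᶠ[nhds x] g) : pd k f x = pd k g x := by
  rw [pd, pd, h.fderiv_eq]

theorem pd_add (hf : DifferentiableAt ℝ f x) (hg : DifferentiableAt ℝ g x) :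
    pd k (fun x => f x + g x) x = pd k f x + pd k g x := by
  rw [pd_eq_of_hasFDerivAt (hf.hasFDerivAt.fun_add hg.hasFDerivAt)]; rfl

theorem pd_mul (hf : DifferentiableAt ℝ f x) (hg : DifferentiableAt ℝ g x) :
    pd k (fun x => f x * g x) x = f x * pd k g x + g x * pd k f x := by
  rw [pd_eq_of_hasFDerivAt (hf.hasFDerivAt.fun_mul hg.hasFDerivAt)]; rfl

theorem pd_const_mul (hf : DifferentiableAt ℝ f x) (c : ℝ) :
    pd k (fun x => c * f x) x = c * pd k f x := by
  rw [pd_eq_of_hasFDerivAt (hf.hasFDerivAt.const_mul c)]; rfl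

theorem pd_sum {ι : Type*} {s : Finset ι} {f : ι → (Fin n → ℝ) → ℝ}
    (hf : ∀ i ∈ s, DifferentiableAt ℝ (f i) x) :
    pd k (fun x => ∑ i ∈ s, f i x) x = ∑ i ∈ s, pd k (f i) x := by
  rw [pd_eq_of_hasFDerivAt (HasFDerivAt.fun_sum fun i hi => (hf i hi).hasFDerivAt)]
  simp [pd]

theorem pd_comp {F : ℝ → ℝ} {F' : ℝ} (hF : HasDerivAt F F' (f x)) (hf : DifferentiableAt ℝ f x) :
    pd k (fun x => F (f x)) x = F' * pd k f x := by
  exact pd_eq_of_hasFDerivAt (f := fun x => F (f x)) (hF.comp_hasFDerivAt x hf.hasFDerivAt) k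

theorem pd_eventuallyEq_zero (h : f =ᶠ[nhds x] fun _ => 0) : pd k f x = 0 := by
  rw [pd_congr h]; simp [pd]

theorem differentiableAt_of_smoothOn (hU : IsOpen U) (hf : ContDiffOn ℝ ∞ f U) (hx : x ∈ U) :
    DifferentiableAt ℝ f x :=
  (hf.contDiffAt (hU.mem_nhds hx)).differentiableAt (by simp)

theorem smoothOn_pd (hU : IsOpen U) (hf : ContDiffOn ℝ ∞ f U) (k : Fin n) :
    ContDiffOn ℝ ∞ (fun x => pd k f x) U :=
  (hf.fderiv_of_isOpen (m := ∞) hU (by simp)).clm_apply contDiffOn_const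

theorem pd_pd_comm (hU : IsOpen U) (hf : ContDiffOn ℝ ∞ f U) (hx : x ∈ U) (j k : Fin n) :
    pd j (fun x => pd k f x) x = pd k (fun x => pd j f x) x := by
  have hs : IsSymmSndFDerivAt ℝ f x :=
    (hf.contDiffAt (hU.mem_nhds hx)).isSymmSndFDerivAt
      (by rw [minSmoothness_of_isRCLikeNormedField]; exact ENat.LEInfty.out)
  have hd : DifferentiableAt ℝ (fderiv ℝ f) x :=
    ((hf.fderiv_of_isOpen (m := ∞) hU (by simp)).contDiffAt (hU.mem_nhds hx)).differentiableAt
      (by simp)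
  have h1 : ∀ v w : Fin n → ℝ, fderiv ℝ (fun x => fderiv ℝ f x v) x w
      = fderiv ℝ (fderiv ℝ f) x w v := by
    intro v w
    rw [fderiv_clm_apply hd (differentiableAt_const v)]
    simp
  unfold pd
  rw [h1, h1]
  exact hs _ _

end PartialDerivatives

/-! ### Smoothness of the tensors involved and the derivative of the squared norm -/

section Smoothness

variable {n : ℕ} {U : Set (Fin n → ℝ)} {a : (Fin n → ℝ) → Matrix (Fin n) (Fin n) ℝ}
  {b : (Fin n → ℝ) → Fin n → ℝ} {x : Fin n → ℝ}

theorem smoothOn_det {M : (Fin n → ℝ) → Matrix (Fin n) (Fin n) ℝ}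
    (h : ∀ i j, ContDiffOn ℝ ∞ (fun x => M x i j) U) : ContDiffOn ℝ ∞ (fun x => (M x).det) U := by
  simp only [Matrix.det_apply']
  exact ContDiffOn.sum fun σ _ => contDiffOn_const.mul (contDiffOn_prod fun i _ => h _ _)

/-- Cramer's rule: the entries are quotients of determinants of smooth matrices. -/
theorem IsRiemannianMetricOn.smoothOn_inv (ha : IsRiemannianMetricOn U a) (i j : Fin n) :
    ContDiffOn ℝ ∞ (fun x => (a x)⁻¹ i j) U := by
  simp only [Matrix.inv_def, Matrix.smul_apply, smul_eq_mul, Ring.inverse_eq_inv',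
    Matrix.adjugate_apply]
  refine ((smoothOn_det ha.smooth).inv fun x hx => (ha.posDef x hx).det_pos.ne').mul
    (smoothOn_det fun k l => ?_)
  by_cases hk : k = j
  · subst hk
    simp only [Matrix.updateRow_self]
    exact contDiffOn_const
  · simp only [Matrix.updateRow_ne hk]
    exact ha.smooth k l

theorem smoothOn_raise (ha : IsRiemannianMetricOn U a) (hb : IsOneFormOn U b) (i : Fin n) :
    ContDiffOn ℝ ∞ (fun x => raise a x (b x) i) U := by
  simp only [raise, Matrix.mulVec, dotProduct]
  exact ContDiffOn.sum fun j _ => (ha.smoothOn_inv i j).mul (hb j)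

theorem smoothOn_normSq (ha : IsRiemannianMetricOn U a) (hb : IsOneFormOn U b) :
    ContDiffOn ℝ ∞ (normSq a b) U := by
  unfold normSq
  simp only [dotProduct]
  exact ContDiffOn.sum fun j _ => (hb j).mul (smoothOn_raise ha hb j)

/-- The first derivatives `∂_k a_ij` of a metric. -/
def metricJet (a : (Fin n → ℝ) → Matrix (Fin n) (Fin n) ℝ) (x : Fin n → ℝ) (i j k : Fin n) : ℝ :=
  pd k (fun x' => a x' i j) x

/-- The first derivatives `∂_j b_i` of a `1`-form. -/
def formJet (b : (Fin n → ℝ) → Fin n → ℝ) (x : Fin n → ℝ) :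
    Matrix (Fin n) (Fin n) ℝ :=
  Matrix.of fun i j => pd j (fun x' => b x' i) x

theorem formJet_apply (b : (Fin n → ℝ) → Fin n → ℝ) (x : Fin n → ℝ) (i j : Fin n) :
    formJet b x i j = pd j (fun x' => b x' i) x := rfl

theorem IsRiemannianMetricOn.symm (ha : IsRiemannianMetricOn U a) (hx : x ∈ U) (i j : Fin n) :
    a x i j = a x j i := posDef_symm (ha.posDef x hx) i j

theorem metricJet_symm (hU : IsOpen U) (ha : IsRiemannianMetricOn U a) (hx : x ∈ U)
    (i j k : Fin n) : metricJet a x i j k = metricJet a x j i k := by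
  refine pd_congr ?_
  filter_upwards [hU.mem_nhds hx] with x' hx'
  exact ha.symm hx' i j

/-- With `e` the vector dual to `b`, differentiating `b_i = a_ij eʲ` instead of `e = a⁻¹ b` avoids
the derivative of the inverse; pairing with `e` expresses `b_i ∂_k eⁱ` through `∂b` and `∂a`. -/
theorem pd_normSq (hU : IsOpen U) (ha : IsRiemannianMetricOn U a) (hb : IsOneFormOn U b)
    (hx : x ∈ U) (k : Fin n) :
    pd k (normSq a b) x = 2 * form2 (formJet b x) (raise a x (b x)) (Pi.single k 1)
      - form3 (metricJet a x) (raise a x (b x)) (raise a x (b x)) (Pi.single k 1) := by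
  have hda : ∀ i j, DifferentiableAt ℝ (fun x => a x i j) x := fun i j =>
    differentiableAt_of_smoothOn hU (ha.smooth i j) hx
  have hdb : ∀ i, DifferentiableAt ℝ (fun x => b x i) x := fun i =>
    differentiableAt_of_smoothOn hU (hb i) hx
  have hde : ∀ i, DifferentiableAt ℝ (fun x => raise a x (b x) i) x := fun i =>
    differentiableAt_of_smoothOn hU (smoothOn_raise ha hb i) hx
  have h1 : ∀ i, formJet b x i k = ∑ j, (a x i j * pd k (fun x => raise a x (b x) j) x
      + raise a x (b x) j * metricJet a x i j k) := by
    intro i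
    have : (fun x => b x i) =ᶠ[nhds x] fun x => ∑ j, a x i j * raise a x (b x) j := by
      filter_upwards [hU.mem_nhds hx] with x' hx'
      exact (congrFun (mulVec_raise (ha.posDef x' hx') (b x')) i).symm
    rw [formJet_apply, pd_congr this, pd_sum fun j _ => (hda i j).fun_mul (hde j)]
    exact Finset.sum_congr rfl fun j _ => pd_mul (hda i j) (hde j)
  have h2 : pd k (normSq a b) x = ∑ i, (b x i * pd k (fun x => raise a x (b x) i) x
      + raise a x (b x) i * formJet b x i k) := by
    change pd k (fun x => ∑ i, b x i * raise a x (b x) i) x = _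
    rw [pd_sum fun i _ => (hdb i).fun_mul (hde i)]
    exact Finset.sum_congr rfl fun i _ => pd_mul (hdb i) (hde i)
  have h3 : ∀ i, b x i = ∑ j, a x i j * raise a x (b x) j := fun i =>
    (congrFun (mulVec_raise (ha.posDef x hx) (b x)) i).symm
  have h4 : form2 (formJet b x) (raise a x (b x)) (Pi.single k 1)
      = ∑ i, raise a x (b x) i * formJet b x i k := by
    rw [form2_apply]
    refine Finset.sum_congr rfl fun i _ => ?_
    simp [Pi.single_apply, mul_comm]
  have h5 : form3 (metricJet a x) (raise a x (b x)) (raise a x (b x)) (Pi.single k 1)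
      = ∑ i, ∑ j, raise a x (b x) i * (raise a x (b x) j * metricJet a x i j k) := by
    rw [form3_apply]
    refine Finset.sum_congr rfl fun i _ => Finset.sum_congr rfl fun j _ => ?_
    simp [Pi.single_apply]
    ring
  have h6 : ∑ i, raise a x (b x) i * formJet b x i k
      = ∑ i, b x i * pd k (fun x => raise a x (b x) i) x
        + ∑ i, ∑ j, raise a x (b x) i * (raise a x (b x) j * metricJet a x i j k) := by
    have : ∑ i, b x i * pd k (fun x => raise a x (b x) i) x
        = ∑ i, ∑ j, raise a x (b x) i * (a x i j * pd k (fun x => raise a x (b x) j) x) := by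
      rw [Finset.sum_comm]
      refine Finset.sum_congr rfl fun j _ => ?_
      rw [h3 j, Finset.sum_mul]
      refine Finset.sum_congr rfl fun i _ => ?_
      rw [ha.symm hx j i]; ring
    rw [this, ← Finset.sum_add_distrib]
    refine Finset.sum_congr rfl fun i _ => ?_
    rw [h1 i, Finset.mul_sum, ← Finset.sum_add_distrib]
    refine Finset.sum_congr rfl fun j _ => ?_
    ring
  rw [h2, h4, h5, Finset.sum_add_distrib, h6]
  ring

end Smoothness

/-! ### Derivatives of functions of `A` and `B` built from `B / √A` -/

section Calculus

variable {E : Type*} [NormedAddCommGroup E] [NormedSpace ℝ E]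

theorem hasFDerivAt_comp_ratio {χ : ℝ → ℝ} {χ' : ℝ} {A B : E → ℝ} {A' B' : E →L[ℝ] ℝ} {x : E}
    (hA : HasFDerivAt A A' x) (hB : HasFDerivAt B B' x) (hpos : 0 < A x)
    (hχ : HasDerivAt χ χ' (B x / √(A x))) :
    HasFDerivAt (fun x => χ (B x / √(A x)))
      ((χ' / √(A x)) • B' - (χ' * (B x / √(A x)) / (2 * A x)) • A') x := by
  have h0 : 0 < √(A x) := Real.sqrt_pos.2 hpos
  have hi : HasFDerivAt (fun x => (√(A x))⁻¹) _ x :=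
    (hasDerivAt_inv h0.ne').comp_hasFDerivAt x (hA.sqrt hpos.ne')
  have h1 := hB.fun_mul hi
  simp only [div_eq_mul_inv] at hχ ⊢
  have h2 : HasFDerivAt (fun x => χ (B x * (√(A x))⁻¹)) _ x := hχ.comp_hasFDerivAt x h1
  refine h2.congr_fderiv ?_
  ext v
  have h3 : √(A x) ^ 2 = A x := Real.sq_sqrt hpos.le
  simp only [smul_apply, add_apply,
    sub_apply, smul_eq_mul]
  rw [← h3, Real.sqrt_sq h0.le]
  field_simp
  ring

theorem hasFDerivAt_sq_alphaBeta {φ : ℝ → ℝ} {φ' : ℝ} {A B : E → ℝ} {A' B' : E →L[ℝ] ℝ} {x : E}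
    (hA : HasFDerivAt A A' x) (hB : HasFDerivAt B B' x) (hpos : 0 < A x)
    (hφ : HasDerivAt φ φ' (B x / √(A x))) :
    HasFDerivAt (fun x => (√(A x) * φ (B x / √(A x))) ^ 2)
      ((φ (B x / √(A x)) ^ 2 - B x / √(A x) * φ (B x / √(A x)) * φ') • A'
        + (√(A x) * (2 * φ (B x / √(A x)) * φ')) • B') x := by
  have h0 : 0 < √(A x) := Real.sqrt_pos.2 hpos
  have h1 := (hA.sqrt hpos.ne').fun_mul (hasFDerivAt_comp_ratio hA hB hpos hφ)
  have h2 := h1.fun_mul h1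
  simp only [sq]
  refine h2.congr_fderiv ?_
  ext v
  have h3 : √(A x) ^ 2 = A x := Real.sq_sqrt hpos.le
  simp only [smul_apply, add_apply,
    sub_apply, smul_eq_mul]
  generalize φ (B x / √(A x)) = f
  rw [← h3, Real.sqrt_sq h0.le]
  field_simp
  ring

theorem hasFDerivAt_sqrt_mul {χ : ℝ → ℝ} {χ' : ℝ} {A B : E → ℝ} {A' B' : E →L[ℝ] ℝ} {x : E}
    (hA : HasFDerivAt A A' x) (hB : HasFDerivAt B B' x) (hpos : 0 < A x)
    (hχ : HasDerivAt χ χ' (B x / √(A x))) :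
    HasFDerivAt (fun x => √(A x) * χ (B x / √(A x)))
      (χ' • B' + ((χ (B x / √(A x)) - B x / √(A x) * χ') / (2 * √(A x))) • A') x := by
  have h0 : 0 < √(A x) := Real.sqrt_pos.2 hpos
  have h1 := (hA.sqrt hpos.ne').fun_mul (hasFDerivAt_comp_ratio hA hB hpos hχ)
  refine h1.congr_fderiv ?_
  ext v
  have h3 : √(A x) ^ 2 = A x := Real.sq_sqrt hpos.le
  simp only [smul_apply, add_apply,
    sub_apply, smul_eq_mul]
  generalize χ (B x / √(A x)) = f
  rw [← h3, Real.sqrt_sq h0.le]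
  field_simp
  ring

end Calculus

/-! ### The dual flatness equation in terms of first jets -/

section DuallyFlat

variable {n : ℕ}

theorem hasFDerivAt_form2 (M : Matrix (Fin n) (Fin n) ℝ) (y : Fin n → ℝ) :
    HasFDerivAt (fun y => form2 M y y)
      (LinearMap.toContinuousLinearMap (form2 M y + (form2 M).flip y)) y := by
  simp only [form2_apply]
  have := HasFDerivAt.fun_sum (u := Finset.univ) fun i _ =>
    HasFDerivAt.fun_sum (u := Finset.univ) fun j _ =>
      ((hasFDerivAt_apply (𝕜 := ℝ) i y).fun_mul (hasFDerivAt_apply (𝕜 := ℝ) j y)).const_mul (M i j)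
  refine this.congr_fderiv ?_
  ext v
  simp [form2_apply, ← Finset.sum_add_distrib, mul_comm]

theorem hasFDerivAt_form1 (b : Fin n → ℝ) (y : Fin n → ℝ) :
    HasFDerivAt (fun y => form1 b y) (LinearMap.toContinuousLinearMap (form1 b)) y :=
  (LinearMap.toContinuousLinearMap (form1 b)).hasFDerivAt

variable {U : Set (Fin n → ℝ)} {a : (Fin n → ℝ) → Matrix (Fin n) (Fin n) ℝ}
  {b : (Fin n → ℝ) → Fin n → ℝ} {x y : Fin n → ℝ}

/-- The derivatives in the direction `x^k` as a form. -/
def metricJetAt (a : (Fin n → ℝ) → Matrix (Fin n) (Fin n) ℝ) (x : Fin n → ℝ) (k : Fin n) :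
    Matrix (Fin n) (Fin n) ℝ :=
  Matrix.of fun i j => metricJet a x i j k

theorem metricJetAt_apply (k i j : Fin n) : metricJetAt a x k i j = metricJet a x i j k := rfl

theorem differentiableAt_form2 (ha : ∀ i j, DifferentiableAt ℝ (fun x => a x i j) x)
    (u v : Fin n → ℝ) : DifferentiableAt ℝ (fun x => form2 (a x) u v) x := by
  simp only [form2_apply]
  exact DifferentiableAt.fun_sum fun i _ => DifferentiableAt.fun_sum fun j _ =>
    (ha i j).mul_const _

theorem pd_form2 (ha : ∀ i j, DifferentiableAt ℝ (fun x => a x i j) x)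
    (u v : Fin n → ℝ) (k : Fin n) :
    pd k (fun x => form2 (a x) u v) x = form2 (metricJetAt a x k) u v := by
  simp only [form2_apply]
  rw [pd_sum fun i _ => DifferentiableAt.fun_sum fun j _ => (ha i j).mul_const _]
  refine Finset.sum_congr rfl fun i _ => ?_
  rw [pd_sum fun j _ => (ha i j).mul_const _]
  refine Finset.sum_congr rfl fun j _ => ?_
  simp only [mul_comm _ (u i * v j)]
  rw [pd_const_mul (ha i j)]; rfl

theorem differentiableAt_form1 (hb : ∀ i, DifferentiableAt ℝ (fun x => b x i) x)
    (u : Fin n → ℝ) : DifferentiableAt ℝ (fun x => form1 (b x) u) x := by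
  simp only [form1_apply]
  exact DifferentiableAt.fun_sum fun i _ => (hb i).mul_const _

theorem pd_form1 (hb : ∀ i, DifferentiableAt ℝ (fun x => b x i) x) (u : Fin n → ℝ) (k : Fin n) :
    pd k (fun x => form1 (b x) u) x = form1 (fun i => formJet b x i k) u := by
  simp only [form1_apply]
  rw [pd_sum fun i _ => (hb i).mul_const _]
  refine Finset.sum_congr rfl fun i _ => ?_
  simp only [mul_comm _ (u i)]
  rw [pd_const_mul (hb i)]; rfl

theorem sum_form2_metricJetAt (u v w : Fin n → ℝ) :
    ∑ k, form2 (metricJetAt a x k) u v * w k = form3 (metricJet a x) u v w := by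
  simp only [form2_apply, form3_apply, Finset.sum_mul]
  rw [Finset.sum_comm]
  refine Finset.sum_congr rfl fun i _ => ?_
  rw [Finset.sum_comm]
  refine Finset.sum_congr rfl fun j _ => Finset.sum_congr rfl fun k _ => ?_
  rw [metricJetAt_apply]; ring

theorem form2_metricJetAt (u v : Fin n → ℝ) (k : Fin n) :
    form2 (metricJetAt a x k) u v = form3 (metricJet a x) u v (Pi.single k 1) := by
  rw [← sum_form2_metricJetAt]; simp [Pi.single_apply]

theorem sum_form1_formJet (u w : Fin n → ℝ) :
    ∑ k, form1 (fun i => formJet b x i k) u * w k = form2 (formJet b x) u w := by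
  simp only [form1_apply, form2_apply, Finset.sum_mul]
  rw [Finset.sum_comm]
  refine Finset.sum_congr rfl fun i _ => Finset.sum_congr rfl fun k _ => ?_
  ring

theorem form1_formJet (u : Fin n → ℝ) (k : Fin n) :
    form1 (fun i => formJet b x i k) u = form2 (formJet b x) u (Pi.single k 1) := by
  rw [← sum_form1_formJet]; simp [Pi.single_apply]

/-- The left hand side of the equation of dual flatness of `α φ(β/α)`, contracted with `v`, in
terms of the first jets `T` of `α²` and `S` of `β`. -/
def flatExpr {V : Type*} [AddCommGroup V] [Module ℝ V] (φ : ℝ → ℝ) (G : V →ₗ[ℝ] V →ₗ[ℝ] ℝ)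
    (β : V →ₗ[ℝ] ℝ) (S : V →ₗ[ℝ] V →ₗ[ℝ] ℝ) (T : V →ₗ[ℝ] V →ₗ[ℝ] V →ₗ[ℝ] ℝ) (v y : V) : ℝ :=
  let s := β y / √(G y y)
  let q := deriv φ s ^ 2 + φ s * deriv (deriv φ) s
  let p := φ s * deriv φ s - s * q
  (φ s ^ 2 - s * φ s * deriv φ s) * (2 * (T v y y - T y y v))
    + √(G y y) * (2 * φ s * deriv φ s) * (S v y - 2 * S y v)
    + (p / √(G y y) * β v - s * p / G y y * G y v) * T y y y
    + (2 * p / √(G y y) * G y v + 2 * q * β v) * S y y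

/-- The `x`-derivative of `F²` is `u(s) ∂_k α² + α w(s) ∂_k β` with `u = φ² - sφφ'` and `w = 2φφ'`;
differentiating in `y` brings in only `u' = p` and `w' = 2q`. -/
theorem duallyFlat_eq_flatExpr (hU : IsOpen U) (ha : IsRiemannianMetricOn U a)
    (hb : IsOneFormOn U b) {I : Set ℝ} (hI : IsOpen I) {φ : ℝ → ℝ} (hφ : ContDiffOn ℝ ∞ φ I)
    (hx : x ∈ U) (hdom : ∀ y, y ≠ 0 → beta b x y / alpha a x y ∈ I) (hy : y ≠ 0) (l : Fin n) :
    ∑ k, pd l (fun y' => pd k (fun x' => alphaBetaFun φ a b x' y' ^ 2) x) y * y k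
      - 2 * pd l (fun x' => alphaBetaFun φ a b x' y ^ 2) x
    = flatExpr φ (form2 (a x)) (form1 (b x)) (form2 (formJet b x)) (form3 (metricJet a x))
      (Pi.single l 1) y := by
  have hda : ∀ i j, DifferentiableAt ℝ (fun x => a x i j) x := fun i j =>
    differentiableAt_of_smoothOn hU (ha.smooth i j) hx
  have hdb : ∀ i, DifferentiableAt ℝ (fun x => b x i) x := fun i =>
    differentiableAt_of_smoothOn hU (hb i) hx
  have hpos : ∀ y, y ≠ 0 → 0 < form2 (a x) y y := posDef_form2_pos (ha.posDef x hx)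
  have hφ1 : ContDiffOn ℝ ∞ (deriv φ) I := hφ.deriv_of_isOpen hI (by simp)
  have hd0 : ∀ s ∈ I, HasDerivAt φ (deriv φ s) s := fun s hs =>
    ((hφ.contDiffAt (hI.mem_nhds hs)).differentiableAt (by simp)).hasDerivAt
  have hd1 : ∀ s ∈ I, HasDerivAt (deriv φ) (deriv (deriv φ) s) s := fun s hs =>
    ((hφ1.contDiffAt (hI.mem_nhds hs)).differentiableAt (by simp)).hasDerivAt
  have hsI : ∀ y, y ≠ 0 → form1 (b x) y / √(form2 (a x) y y) ∈ I := by
    intro y hy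
    have := hdom y hy
    rwa [beta_eq_form1, alpha_eq] at this
  set u : ℝ → ℝ := fun s => φ s ^ 2 - s * φ s * deriv φ s with hu
  set w : ℝ → ℝ := fun s => 2 * φ s * deriv φ s with hw
  have hpd : ∀ y, y ≠ 0 → ∀ k, pd k (fun x' => alphaBetaFun φ a b x' y ^ 2) x
      = u (form1 (b x) y / √(form2 (a x) y y)) * form2 (metricJetAt a x k) y y
        + √(form2 (a x) y y) * w (form1 (b x) y / √(form2 (a x) y y))
          * form1 (fun i => formJet b x i k) y := by
    intro y hy k
    have h1 := hasFDerivAt_sq_alphaBeta (differentiableAt_form2 hda y y).hasFDerivAt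
      (differentiableAt_form1 hdb y).hasFDerivAt (hpos y hy) (hd0 _ (hsI y hy))
    simp only [alphaBetaFun, alpha_eq, beta_eq_form1]
    rw [pd_eq_of_hasFDerivAt h1, ← pd_form2 hda, ← pd_form1 hdb]
    rfl
  set s := form1 (b x) y / √(form2 (a x) y y) with hs
  have hsI' := hsI y hy
  rw [← hs] at hsI'
  set q := deriv φ s ^ 2 + φ s * deriv (deriv φ) s with hq
  set p := φ s * deriv φ s - s * q with hp
  have hdu : HasDerivAt u p s := by
    refine (((hd0 s hsI').fun_pow 2).fun_sub
      (((hasDerivAt_id s).fun_mul (hd0 s hsI')).fun_mul (hd1 s hsI'))).congr_deriv ?_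
    simp [hp, hq]; ring
  have hdw : HasDerivAt w (2 * q) s := by
    refine (((hd0 s hsI').const_mul 2).fun_mul (hd1 s hsI')).congr_deriv ?_
    simp [hq]; ring
  have hpos' := hpos y hy
  have hA := hasFDerivAt_form2 (a x) y
  have hB := hasFDerivAt_form1 (b x) y
  have hpdl : ∀ k, pd l (fun y' => pd k (fun x' => alphaBetaFun φ a b x' y' ^ 2) x) y
      = (p / √(form2 (a x) y y) * b x l - s * p / form2 (a x) y y * form2 (a x) y (Pi.single l 1))
          * form2 (metricJetAt a x k) y y
        + u s * (2 * form2 (metricJetAt a x k) (Pi.single l 1) y)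
        + (2 * p / √(form2 (a x) y y) * form2 (a x) y (Pi.single l 1) + 2 * q * b x l)
          * form1 (fun i => formJet b x i k) y
        + √(form2 (a x) y y) * w s * formJet b x l k := by
    intro k
    have hev : (fun y' => pd k (fun x' => alphaBetaFun φ a b x' y' ^ 2) x) =ᶠ[nhds y]
        fun y => u (form1 (b x) y / √(form2 (a x) y y)) * form2 (metricJetAt a x k) y y
        + √(form2 (a x) y y) * w (form1 (b x) y / √(form2 (a x) y y))
          * form1 (fun i => formJet b x i k) y := by
      filter_upwards [isOpen_ne.mem_nhds hy] with y' hy'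
      exact hpd y' hy' k
    rw [pd_congr hev]
    have h1 := ((hasFDerivAt_comp_ratio hA hB hpos' hdu).fun_mul
      (hasFDerivAt_form2 (metricJetAt a x k) y)).fun_add
      ((hasFDerivAt_sqrt_mul hA hB hpos' hdw).fun_mul
      (hasFDerivAt_form1 (fun i => formJet b x i k) y))
    rw [pd_eq_of_hasFDerivAt h1]
    simp only [add_apply, smul_apply,
      sub_apply, LinearMap.coe_toContinuousLinearMap', smul_eq_mul,
      LinearMap.add_apply, LinearMap.flip_apply, form1_single]
    rw [← hs, form2_comm (ha.symm hx) (Pi.single l 1) y,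
      form2_comm (M := metricJetAt a x k) (fun i j => metricJet_symm hU ha hx i j k) y
        (Pi.single l 1)]
    -- This makes the derivative of `α w(s)` with respect to `α` expressible through `p`, so no
    -- further function of `s` appears.
    have : w s - s * (2 * q) = 2 * p := by simp only [hw, hp]; ring
    rw [this]
    have := (Real.sqrt_pos.2 hpos').ne'
    field_simp
    ring
  simp only [hpdl]
  rw [hpd y hy l, ← hs]
  simp only [add_mul, Finset.sum_add_distrib]
  have e1 := sum_form2_metricJetAt (a := a) (x := x) y y y
  have e2 := sum_form2_metricJetAt (a := a) (x := x) (Pi.single l 1) y y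
  have e3 := sum_form1_formJet (b := b) (x := x) y y
  have e4 := sum_form1_formJet (b := b) (x := x) (Pi.single l 1) y
  simp only [form1_single] at e4
  have r1 : ∀ c : ℝ, ∑ k, c * form2 (metricJetAt a x k) y y * y k
      = c * form3 (metricJet a x) y y y := fun c => by
    rw [← e1, Finset.mul_sum]; simp only [mul_assoc]
  have r2 : ∀ c : ℝ, ∑ k, c * (2 * form2 (metricJetAt a x k) (Pi.single l 1) y) * y k
      = c * (2 * form3 (metricJet a x) (Pi.single l 1) y y) := fun c => by
    rw [← e2, Finset.mul_sum, Finset.mul_sum]; simp only [mul_assoc]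
  have r3 : ∀ c : ℝ, ∑ k, c * form1 (fun i => formJet b x i k) y * y k
      = c * form2 (formJet b x) y y := fun c => by
    rw [← e3, Finset.mul_sum]; simp only [mul_assoc]
  have r4 : ∀ c : ℝ, ∑ k, c * formJet b x l k * y k
      = c * form2 (formJet b x) (Pi.single l 1) y := fun c => by
    rw [← e4, Finset.mul_sum]; simp only [mul_assoc]
  simp only [r1, r2, r3, r4]
  rw [form2_metricJetAt, form1_formJet, flatExpr]
  simp only [← hs, ← hq, ← hp, form1_single, hu, hw]
  ring

end DuallyFlat

/-! ### From dual flatness at a point to the flat jet, and back -/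

section PointwiseFlat

/-- The expression involves `u = φ² - sφφ'`, `p = φφ' - sq`, `q = φ'² + φφ''` and `φφ' = p + sq`.
The differential equation reads `q = s(k₂ - k₃s²) p + k₁ u`, so only `u` and `p` remain; their
coefficients are the even and the odd part. -/
theorem flatExpr_eq_add {V : Type*} [AddCommGroup V] [Module ℝ V] {k₁ k₂ k₃ : ℝ} {I : Set ℝ}
    {φ : ℝ → ℝ} (hode : SolvesODE k₁ k₂ k₃ I φ) {G : V →ₗ[ℝ] V →ₗ[ℝ] ℝ} {β : V →ₗ[ℝ] ℝ}
    {S : V →ₗ[ℝ] V →ₗ[ℝ] ℝ} {T : V →ₗ[ℝ] V →ₗ[ℝ] V →ₗ[ℝ] ℝ} {v y : V} (hpos : 0 < G y y)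
    (hs : β y / √(G y y) ∈ I) :
    flatExpr φ G β S T v y
      = (fun s => φ s ^ 2 - s * φ s * deriv φ s) (β y / √(G y y)) * evenPart k₁ β S T v y
        + (fun s => φ s * deriv φ s - s * (deriv φ s ^ 2 + φ s * deriv (deriv φ) s))
            (β y / √(G y y)) / (G y y * √(G y y)) * oddPart k₂ k₃ G β S T v y := by
  have h := hode _ hs
  set A := G y y with hA
  have hr : 0 < √A := Real.sqrt_pos.2 hpos
  have hB : β y = (β y / √A) * √A := by field_simp
  have hr2 : A = √A ^ 2 := (Real.sq_sqrt hpos.le).symm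
  simp only [flatExpr, evenPart, oddPart, ← hA]
  set s := β y / √A with hsd
  rw [hB]
  set r := √A with hrd
  rw [hr2]
  have hode' : deriv φ s ^ 2 + φ s * deriv (deriv φ) s
      = s * (k₂ - k₃ * s ^ 2) * (φ s * deriv φ s
          - s * (deriv φ s ^ 2 + φ s * deriv (deriv φ) s))
        + k₁ * (φ s ^ 2 - s * φ s * deriv φ s) := by linear_combination -h
  generalize hq : deriv φ s ^ 2 + φ s * deriv (deriv φ) s = q at hode' ⊢
  generalize hp : φ s * deriv φ s - s * q = p at hode' ⊢
  have hw : 2 * φ s * deriv φ s = 2 * (p + s * q) := by rw [← hp]; ring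
  rw [hw, hode']
  generalize φ s ^ 2 - s * φ s * deriv φ s = u
  field_simp
  ring

variable {n : ℕ} {U : Set (Fin n → ℝ)} {a : (Fin n → ℝ) → Matrix (Fin n) (Fin n) ℝ}
  {b : (Fin n → ℝ) → Fin n → ℝ} {x : Fin n → ℝ} {k₁ k₂ k₃ : ℝ} {I : Set ℝ} {φ : ℝ → ℝ}

theorem exists_orthogonal_ne_zero (hn : 2 ≤ n) (β : (Fin n → ℝ) →ₗ[ℝ] ℝ) :
    ∃ u, u ≠ 0 ∧ β u = 0 := by
  have h : LinearMap.ker β ≠ ⊥ := by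
    intro h
    have h1 := LinearMap.finrank_range_add_finrank_ker β
    rw [h, finrank_bot, Module.finrank_fin_fun] at h1
    have h2 := Submodule.finrank_le (LinearMap.range β)
    rw [Module.finrank_self] at h2
    omega
  obtain ⟨u, hu, hu0⟩ := Submodule.exists_mem_ne_zero_of_ne_bot h
  exact ⟨u, hu0, hu⟩

/-- The expression is linear in `v`, so the coordinate directions suffice. -/
theorem flatExpr_eq_zero_of_single {φ : ℝ → ℝ} {G : (Fin n → ℝ) →ₗ[ℝ] (Fin n → ℝ) →ₗ[ℝ] ℝ}
    {β : (Fin n → ℝ) →ₗ[ℝ] ℝ} {S : (Fin n → ℝ) →ₗ[ℝ] (Fin n → ℝ) →ₗ[ℝ] ℝ}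
    {T : (Fin n → ℝ) →ₗ[ℝ] (Fin n → ℝ) →ₗ[ℝ] (Fin n → ℝ) →ₗ[ℝ] ℝ} {y : Fin n → ℝ}
    (h : ∀ l, flatExpr φ G β S T (Pi.single l 1) y = 0) (v : Fin n → ℝ) :
    flatExpr φ G β S T v y = 0 := by
  set L : (Fin n → ℝ) →ₗ[ℝ] ℝ :=
    { toFun := fun v => flatExpr φ G β S T v y
      map_add' := fun v w => by
        simp only [flatExpr, map_add, LinearMap.add_apply]; ring
      map_smul' := fun c v => by
        simp only [flatExpr, map_smul, LinearMap.smul_apply, smul_eq_mul, RingHom.id_apply]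
        ring } with hL
  have : L = 0 := LinearMap.pi_ext' fun i => LinearMap.ext_ring (by exact h i)
  exact LinearMap.congr_fun this v

theorem exists_hasFlatJet_of_flatExpr (hn : 2 ≤ n) (hU : IsOpen U)
    (ha : IsRiemannianMetricOn U a) (hI : IsSymmetricOpenInterval I)
    (hφ : ContDiffOn ℝ ∞ φ I) (hφpos : ∀ s ∈ I, 0 < φ s) (hφ0 : deriv φ 0 ≠ 0)
    (hode : SolvesODE k₁ k₂ k₃ I φ) (hx : x ∈ U)
    (hdom : ∀ y, y ≠ 0 → beta b x y / alpha a x y ∈ I) (hbx : b x ≠ 0)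
    (hadm : 0 < deformQ k₂ k₃ (normSq a b x))
    (h : ∀ y, y ≠ 0 → ∀ l, flatExpr φ (form2 (a x)) (form1 (b x)) (form2 (formJet b x))
      (form3 (metricJet a x)) (Pi.single l 1) y = 0) :
    ∃ θ m, HasFlatJet k₁ k₂ k₃ (form2 (a x)) (form1 (b x)) (form2 (formJet b x))
      (form3 (metricJet a x)) θ m := by
  have hp := ha.posDef x hx
  have hG := posDef_form2_pos hp
  have hGs := form2_comm (posDef_symm hp)
  have hφ1 : ContDiffOn ℝ ∞ (deriv φ) I := hφ.deriv_of_isOpen hI.isOpen (by simp)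
  have hφ2 : ContDiffOn ℝ ∞ (deriv (deriv φ)) I := hφ1.deriv_of_isOpen hI.isOpen (by simp)
  have hn0 := hI.isOpen.mem_nhds hI.zero_mem
  have c0 : ContinuousAt φ 0 := hφ.continuousOn.continuousAt hn0
  have c1 : ContinuousAt (deriv φ) 0 := hφ1.continuousOn.continuousAt hn0
  have c2 : ContinuousAt (deriv (deriv φ)) 0 := hφ2.continuousOn.continuousAt hn0
  have hφ00 := hφpos 0 hI.zero_mem
  obtain ⟨u₀, hu₀, hβu⟩ := exists_orthogonal_ne_zero hn (form1 (b x))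
  have hXY := evenPart_oddPart_eq_zero (k₁ := k₁) (k₂ := k₂) (k₃ := k₃) (G := form2 (a x))
    (β := form1 (b x)) (S := form2 (formJet b x)) (T := form3 (metricJet a x)) hG hu₀ hβu
    (f := fun s => φ s ^ 2 - s * φ s * deriv φ s)
    (g := fun s => φ s * deriv φ s - s * (deriv φ s ^ 2 + φ s * deriv (deriv φ) s))
    (by fun_prop) (by fun_prop) (by simp; positivity)
    (by simpa using ⟨hφ00.ne', hφ0⟩)
    (fun v y hy => by
      have hs := hdom y hy
      rw [beta_eq_form1, alpha_eq] at hs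
      rw [← flatExpr_eq_add hode (hG y hy) hs]
      exact flatExpr_eq_zero_of_single (h y hy) v)
  have ht := normSq_pos hp hbx
  rw [normSq_eq_form1] at ht hadm
  exact exists_hasFlatJet hGs hG (form3_comm fun i j k => metricJet_symm hU ha hx i j k) hu₀ hβu
    (form2_raise_left hp (b x)) ht hadm (fun v y => (hXY v y).1) (fun v y => (hXY v y).2)

theorem flatExpr_eq_zero_of_hasFlatJet (ha : IsRiemannianMetricOn U a)
    (hode : SolvesODE k₁ k₂ k₃ I φ) (hx : x ∈ U)
    (hdom : ∀ y, y ≠ 0 → beta b x y / alpha a x y ∈ I) {θ : (Fin n → ℝ) →ₗ[ℝ] ℝ} {m : ℝ}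
    (h : HasFlatJet k₁ k₂ k₃ (form2 (a x)) (form1 (b x)) (form2 (formJet b x))
      (form3 (metricJet a x)) θ m) {y : Fin n → ℝ} (hy : y ≠ 0) (v : Fin n → ℝ) :
    flatExpr φ (form2 (a x)) (form1 (b x)) (form2 (formJet b x))
      (form3 (metricJet a x)) v y = 0 := by
  have hp := ha.posDef x hx
  have hGs := form2_comm (posDef_symm hp)
  have hs := hdom y hy
  rw [beta_eq_form1, alpha_eq] at hs
  rw [flatExpr_eq_add hode (posDef_form2_pos hp y hy) hs, h.evenPart_eq_zero hGs,
    h.oddPart_eq_zero hGs, mul_zero, mul_zero, add_zero]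

end PointwiseFlat

/-! ### Spray and covariant derivative conditions as conditions on first jets -/

section DualRelation

variable {n : ℕ} {U : Set (Fin n → ℝ)} {a : (Fin n → ℝ) → Matrix (Fin n) (Fin n) ℝ}
  {b : (Fin n → ℝ) → Fin n → ℝ} {x : Fin n → ℝ}

/-- The first jet at `x` of a dually flat metric and of a dually related `1`-form. -/
def HasDualJetAt (a : (Fin n → ℝ) → Matrix (Fin n) (Fin n) ℝ) (b : (Fin n → ℝ) → Fin n → ℝ)
    (x : Fin n → ℝ) (θ : Fin n → ℝ) (c : ℝ) : Prop :=
  (∀ i j k, metricJet a x i j k = 4 * (θ i * a x j k + θ j * a x i k + θ k * a x i j)) ∧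
  (∀ i j, formJet b x i j = 4 * θ i * b x j + 2 * θ j * b x i + c * a x i j)

/-- In `2 S(e, ∂_k) - T(e, e, ∂_k)`, `e` being dual to `b`, all terms containing `θ` cancel. -/
theorem HasDualJetAt.pd_normSq {U : Set (Fin n → ℝ)} (hU : IsOpen U)
    (ha : IsRiemannianMetricOn U a) (hb : IsOneFormOn U b) (hx : x ∈ U) {θ : Fin n → ℝ} {c : ℝ}
    (h : HasDualJetAt a b x θ c) (k : Fin n) : pd k (normSq a b) x = 2 * c * b x k := by
  have hp := ha.posDef x hx
  have h1 : form2 (metricJetAt a x k)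
      = (4 : ℝ) • ((form1 θ).smulRight (form2 (a x) (Pi.single k 1))
        + (form2 (a x) (Pi.single k 1)).smulRight (form1 θ) + θ k • form2 (a x)) := by
    refine linearMap_ext2 fun i j => ?_
    simp only [form2_single, LinearMap.smul_apply, LinearMap.add_apply,
      LinearMap.smulRight_apply, form1_single, smul_eq_mul]
    rw [metricJetAt_apply, h.1, ha.symm hx k j, ha.symm hx k i]
    ring
  have h2 : form2 (formJet b x) = (4 : ℝ) • (form1 θ).smulRight (form1 (b x))
      + (2 : ℝ) • (form1 (b x)).smulRight (form1 θ) + c • form2 (a x) := by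
    refine linearMap_ext2 fun i j => ?_
    simp only [form2_single, LinearMap.smul_apply, LinearMap.add_apply,
      LinearMap.smulRight_apply, form1_single, smul_eq_mul]
    rw [h.2]
    ring
  rw [AlphaBeta.pd_normSq hU ha hb hx, ← form2_metricJetAt, h1, h2]
  simp only [LinearMap.smul_apply, LinearMap.add_apply,
    LinearMap.smulRight_apply, form1_single, smul_eq_mul, form2_raise hp, form2_raise_left hp]
  ring

theorem form2_ext_of_quadratic {M N : Matrix (Fin n) (Fin n) ℝ} (hM : ∀ i j, M i j = M j i)
    (hN : ∀ i j, N i j = N j i) (h : ∀ y, form2 M y y = form2 N y y) : M = N := by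
  ext i j
  have h1 := h (Pi.single i 1 + Pi.single j 1)
  have h2 := h (Pi.single i 1)
  have h3 := h (Pi.single j 1)
  simp only [map_add, LinearMap.add_apply, form2_single] at h1 h2 h3
  rw [hM j i, hN j i] at h1
  linarith

/-- Twice the Christoffel symbols of the first kind. -/
def lowerChristoffel (a : (Fin n → ℝ) → Matrix (Fin n) (Fin n) ℝ) (x : Fin n → ℝ)
    (m j k : Fin n) : ℝ :=
  metricJet a x m k j + metricJet a x m j k - metricJet a x j k m

theorem christoffel_eq_raise (i j k : Fin n) :
    christoffel a x i j k = 1 / 2 * raise a x (fun m => lowerChristoffel a x m j k) i := rfl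

theorem sum_christoffel_mul (h : (a x).PosDef) (ξ : Fin n → ℝ) (i j : Fin n) :
    ∑ k, christoffel a x k i j * ξ k
      = 1 / 2 * form1 (fun m => lowerChristoffel a x m i j) (raise a x ξ) := by
  rw [← form2_raise_left h, form2_raise h, form1_apply, Finset.mul_sum]
  refine Finset.sum_congr rfl fun k _ => ?_
  rw [christoffel_eq_raise]; ring

theorem lowerChristoffel_add (hU : IsOpen U) (ha : IsRiemannianMetricOn U a) (hx : x ∈ U)
    (m j k : Fin n) :
    lowerChristoffel a x m j k + lowerChristoffel a x j m k = 2 * metricJet a x m j k := by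
  rw [lowerChristoffel, lowerChristoffel, metricJet_symm hU ha hx j m k]
  ring

theorem lowerChristoffel_symm (hU : IsOpen U) (ha : IsRiemannianMetricOn U a) (hx : x ∈ U)
    (m j k : Fin n) : lowerChristoffel a x m j k = lowerChristoffel a x m k j := by
  rw [lowerChristoffel, lowerChristoffel, metricJet_symm hU ha hx j k m]
  ring

theorem raise_sym (h : (a x).PosDef) (θ : Fin n → ℝ) (j k : Fin n) :
    raise a x (fun m => 4 * (θ m * a x j k + θ j * a x m k + θ k * a x m j))
      = (4 * a x j k) • raise a x θ + (4 * θ j) • Pi.single k 1 + (4 * θ k) • Pi.single j 1 := by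
  refine raise_eq_of_mulVec h ?_
  ext m
  rw [mulVec_eq_form2]
  simp only [map_add, map_smul, form2_raise h, form2_single, form1_single, smul_eq_mul]
  ring

/-- The coefficients `Γⁱ_jk` which the first dual relation prescribes. -/
def dualChristoffel (a : (Fin n → ℝ) → Matrix (Fin n) (Fin n) ℝ) (x : Fin n → ℝ) (θ : Fin n → ℝ)
    (i : Fin n) : Matrix (Fin n) (Fin n) ℝ :=
  Matrix.of fun j k => 1 / 2 * ((4 * a x j k) • raise a x θ + (4 * θ j) • Pi.single k 1
    + (4 * θ k) • Pi.single j 1 : Fin n → ℝ) i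

theorem form2_dualChristoffel (θ : Fin n → ℝ) (i : Fin n) (y : Fin n → ℝ) :
    1 / 2 * form2 (dualChristoffel a x θ i) y y
      = 2 * form1 θ y * y i + form2 (a x) y y * raise a x θ i := by
  have : form2 (dualChristoffel a x θ i) = (2 * raise a x θ i) • form2 (a x)
      + (2 : ℝ) • (LinearMap.proj i : (Fin n → ℝ) →ₗ[ℝ] ℝ).smulRight (form1 θ)
      + (2 : ℝ) • (form1 θ).smulRight (LinearMap.proj i : (Fin n → ℝ) →ₗ[ℝ] ℝ) := by
    refine linearMap_ext2 fun j k => ?_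
    simp only [form2_single, dualChristoffel, Matrix.of_apply, LinearMap.add_apply,
      LinearMap.smul_apply, LinearMap.smulRight_apply, LinearMap.proj_apply, form1_single,
      Pi.add_apply, Pi.smul_apply, smul_eq_mul, Pi.single_apply]
    rcases eq_or_ne i j with rfl | h1 <;> rcases eq_or_ne i k with rfl | h2 <;>
      simp [*] <;> ring
  rw [this]
  simp only [LinearMap.add_apply, LinearMap.smul_apply, LinearMap.smulRight_apply,
    LinearMap.proj_apply, smul_eq_mul]
  ring

theorem spray_eq_form2 (y : Fin n → ℝ) (i : Fin n) :
    spray a x y i = 1 / 2 * form2 (Matrix.of fun j k => christoffel a x i j k) y y := by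
  rw [spray, form2_apply]
  congr 1
  refine Finset.sum_congr rfl fun j _ => Finset.sum_congr rfl fun k _ => ?_
  simp only [Matrix.of_apply]; ring

/-- Polarisation in `y` turns the spray equation into a formula for the Christoffel symbols.
Lowering the index and adding the formula with two indices exchanged recovers `∂_k a_ij`, as in the
Koszul formula. -/
theorem spray_eq_iff (hU : IsOpen U) (ha : IsRiemannianMetricOn U a) (hx : x ∈ U)
    (θ : Fin n → ℝ) :
    (∀ y i, spray a x y i = 2 * form1 θ y * y i + alpha a x y ^ 2 * raise a x θ i) ↔
    ∀ i j k, metricJet a x i j k = 4 * (θ i * a x j k + θ j * a x i k + θ k * a x i j) := by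
  have hp := ha.posDef x hx
  constructor
  · intro h
    have hΓ : ∀ i, (Matrix.of fun j k => christoffel a x i j k) = dualChristoffel a x θ i := by
      intro i
      refine form2_ext_of_quadratic ?_ ?_ fun y => ?_
      · intro j k
        simp only [Matrix.of_apply, christoffel_eq_raise]
        simp only [lowerChristoffel_symm hU ha hx _ j k]
      · intro j k
        simp only [dualChristoffel, Matrix.of_apply, ha.symm hx j k]
        rw [add_right_comm]
      · have h1 := h y i
        rw [spray_eq_form2, alpha_sq hp, ← form2_dualChristoffel] at h1
        linarith
    have hC : ∀ m j k, lowerChristoffel a x m j k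
        = 4 * (θ m * a x j k + θ j * a x m k + θ k * a x m j) := by
      intro m j k
      have h2 : raise a x (fun m => lowerChristoffel a x m j k)
          = raise a x (fun m => 4 * (θ m * a x j k + θ j * a x m k + θ k * a x m j)) := by
        rw [raise_sym hp]
        ext i
        have h3 := congrFun (congrFun (hΓ i) j) k
        simp only [Matrix.of_apply, christoffel_eq_raise, dualChristoffel] at h3
        linarith
      have h4 := congrArg (fun e => (a x *ᵥ e) m) h2
      simpa only [mulVec_raise hp] using h4
    intro i j k
    have h5 := lowerChristoffel_add hU ha hx i j k
    rw [hC, hC, ha.symm hx j i] at h5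
    linarith
  · intro h y i
    rw [spray_eq_form2, alpha_sq hp, ← form2_dualChristoffel]
    have hC : ∀ j k, (fun m => lowerChristoffel a x m j k)
        = fun m => 4 * (θ m * a x j k + θ j * a x m k + θ k * a x m j) := by
      intro j k
      ext m
      rw [lowerChristoffel, h, h, h, ha.symm hx k j, ha.symm hx j m, ha.symm hx k m]
      ring
    have hM : (Matrix.of fun j k => christoffel a x i j k) = dualChristoffel a x θ i := by
      ext j k
      simp only [Matrix.of_apply, christoffel_eq_raise, dualChristoffel, ← raise_sym hp, hC]
    rw [hM]

theorem covDeriv_eq (ha : IsRiemannianMetricOn U a) (hx : x ∈ U) {θ : Fin n → ℝ}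
    (h : ∀ i j k, metricJet a x i j k = 4 * (θ i * a x j k + θ j * a x i k + θ k * a x i j))
    (i j : Fin n) :
    covDeriv a b x i j = formJet b x i j - 2 * (form1 θ (raise a x (b x)) * a x i j
      + θ i * b x j + θ j * b x i) := by
  have hp := ha.posDef x hx
  rw [covDeriv, sum_christoffel_mul hp, formJet_apply]
  have : form1 (fun m => lowerChristoffel a x m i j) = (4 * a x i j) • form1 θ
      + (4 * θ i) • form2 (a x) (Pi.single j 1) + (4 * θ j) • form2 (a x) (Pi.single i 1) := by
    refine LinearMap.pi_ext' fun m => LinearMap.ext_ring ?_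
    simp only [LinearMap.comp_apply, LinearMap.single_apply, LinearMap.add_apply,
      LinearMap.smul_apply, form1_single, form2_single, smul_eq_mul]
    rw [lowerChristoffel, h, h, h, ha.symm hx j i, ha.symm hx m j, ha.symm hx m i]
    ring
  rw [this]
  simp only [LinearMap.add_apply, LinearMap.smul_apply, form2_raise hp, form1_single, smul_eq_mul]
  ring

/-- Expanding the covariant derivative doubles the `θ_i b_j` term, adds `2 θ_j b_i`, and shifts the
scalar `c` by twice the scalar product of `θ` and `b`. -/
theorem isDuallyRelatedOn_iff (hU : IsOpen U) (ha : IsRiemannianMetricOn U a)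
    (hb : IsOneFormOn U b) :
    IsDuallyRelatedOn U a b ↔ ∃ (θ : (Fin n → ℝ) → Fin n → ℝ) (c : (Fin n → ℝ) → ℝ),
      IsOneFormOn U θ ∧ ContDiffOn ℝ ∞ c U ∧ ∀ x ∈ U, HasDualJetAt a b x (θ x) (c x) := by
  have hs : ∀ {θ : (Fin n → ℝ) → Fin n → ℝ}, IsOneFormOn U θ →
      ContDiffOn ℝ ∞ (fun x => 2 * form1 (θ x) (raise a x (b x))) U := by
    intro θ hθ
    simp only [form1_apply]
    exact contDiffOn_const.mul (ContDiffOn.sum fun i _ => (hθ i).mul (smoothOn_raise ha hb i))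
  constructor
  · rintro ⟨θ, c, hθ, hc, h1, h2⟩
    refine ⟨θ, fun x => c x + 2 * form1 (θ x) (raise a x (b x)), hθ, hc.add (hs hθ),
      fun x hx => ?_⟩
    have h3 := (spray_eq_iff hU ha hx (θ x)).1 fun y i => by
      rw [← beta_eq_form1]; exact h1 x hx y i
    refine ⟨h3, fun i j => ?_⟩
    have h4 := h2 x hx i j
    rw [covDeriv_eq ha hx h3] at h4
    linarith
  · rintro ⟨θ, c, hθ, hc, h⟩
    refine ⟨θ, fun x => c x - 2 * form1 (θ x) (raise a x (b x)), hθ, hc.sub (hs hθ),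
      fun x hx y i => ?_, fun x hx i j => ?_⟩
    · rw [beta_eq_form1]
      exact (spray_eq_iff hU ha hx (θ x)).2 (h x hx).1 y i
    · rw [covDeriv_eq ha hx (h x hx).1, (h x hx).2]
      ring

/-- For `φ = 1` and `b = 0` only `2 (T v y y - T y y v)` is left of `flatExpr`, and it vanishes when
`∂_k a_ij` is totally symmetric. -/
theorem isDuallyFlatOn_alpha (hU : IsOpen U) (ha : IsRiemannianMetricOn U a)
    (h : ∀ x ∈ U, ∀ i j k, metricJet a x i j k = metricJet a x k j i) :
    IsDuallyFlatOn U (alpha a) := by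
  have e : alpha a = alphaBetaFun (fun _ => 1) a 0 := by
    funext x y; simp [alphaBetaFun]
  intro x hx y hy l
  rw [e, duallyFlat_eq_flatExpr hU ha (b := 0) (fun i => contDiffOn_const) isOpen_univ
    contDiffOn_const hx (fun _ _ => Set.mem_univ _) hy l]
  have h2 : form3 (metricJet a x) (Pi.single l 1) y y = form3 (metricJet a x) y y (Pi.single l 1) := by
    rw [← sum_form2_metricJetAt, ← form2_metricJetAt]
    rw [form2_apply, Finset.sum_comm]
    refine Finset.sum_congr rfl fun j _ => ?_
    rw [form2_comm (M := metricJetAt a x j) (metricJet_symm hU ha hx · · j), form2_apply]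
    rw [Finset.sum_mul]
    refine Finset.sum_congr rfl fun i _ => ?_
    simp [Pi.single_apply, metricJetAt_apply]
    rw [metricJet_symm hU ha hx i l j, h x hx l i j, metricJet_symm hU ha hx j i l]
    ring
  simp [flatExpr, h2]

end DualRelation

/-! ### How the deformation transforms the jets -/

section Deformation

variable {n : ℕ} {U : Set (Fin n → ℝ)} {a a' : (Fin n → ℝ) → Matrix (Fin n) (Fin n) ℝ}
  {b b' : (Fin n → ℝ) → Fin n → ℝ} {x : Fin n → ℝ} {k₁ k₂ k₃ : ℝ}

theorem hasFlatJet_of_coefficients {θ : Fin n → ℝ} {m : ℝ}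
    (hT : ∀ i j k, metricJet a x i j k = 4 * (θ i * a x j k + θ j * a x i k + θ k * a x i j)
      + 2 * m * (k₁ * b x k * a x i j + 2 * k₃ * b x i * b x j * b x k))
    (hS : ∀ i j, formJet b x i j = 4 * θ i * b x j + 2 * θ j * b x i
      + m * (2 * a x i j + (k₁ + 2 * k₂) * b x i * b x j)) (hs : ∀ i j, a x i j = a x j i) :
    HasFlatJet k₁ k₂ k₃ (form2 (a x)) (form1 (b x)) (form2 (formJet b x))
      (form3 (metricJet a x)) (form1 θ) m := by
  constructor
  · intro u v w
    have h1 : ∀ k, form2 (metricJetAt a x k)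
        = (4 : ℝ) • ((form1 θ).smulRight (form2 (a x) (Pi.single k 1))
          + (form2 (a x) (Pi.single k 1)).smulRight (form1 θ) + θ k • form2 (a x))
          + (2 * m) • ((k₁ * b x k) • form2 (a x)
          + (2 * k₃ * b x k) • (form1 (b x)).smulRight (form1 (b x))) := by
      refine fun k => linearMap_ext2 fun i j => ?_
      simp only [form2_single, LinearMap.smul_apply, LinearMap.add_apply,
        LinearMap.smulRight_apply, form1_single, smul_eq_mul]
      rw [metricJetAt_apply, hT, hs k j, hs k i]
      ring
    have h2 : form3 (metricJet a x) u v = (4 : ℝ) • (form1 θ u • form2 (a x) v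
        + form1 θ v • form2 (a x) u + form2 (a x) u v • form1 θ)
        + (2 * m) • ((k₁ * form2 (a x) u v) • form1 (b x)
        + (2 * k₃ * form1 (b x) u * form1 (b x) v) • form1 (b x)) := by
      refine LinearMap.pi_ext' fun k => LinearMap.ext_ring ?_
      simp only [LinearMap.comp_apply, LinearMap.single_apply]
      rw [← form2_metricJetAt, h1]
      simp only [LinearMap.smul_apply, LinearMap.add_apply,
        LinearMap.smulRight_apply, form1_single, smul_eq_mul, form2_comm hs (Pi.single k 1)]
      ring
    rw [h2]
    simp only [LinearMap.smul_apply, LinearMap.add_apply, smul_eq_mul]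
    ring
  · intro u v
    have h2 : form2 (formJet b x) = (4 : ℝ) • (form1 θ).smulRight (form1 (b x))
        + (2 : ℝ) • (form1 (b x)).smulRight (form1 θ) + m • ((2 : ℝ) • form2 (a x)
        + (k₁ + 2 * k₂) • (form1 (b x)).smulRight (form1 (b x))) := by
      refine linearMap_ext2 fun i j => ?_
      simp only [form2_single, LinearMap.smul_apply, LinearMap.add_apply,
        LinearMap.smulRight_apply, form1_single, smul_eq_mul]
      rw [hS]
      ring
    rw [h2]
    simp only [LinearMap.smul_apply, LinearMap.add_apply, LinearMap.smulRight_apply, smul_eq_mul]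
    ring

/-- Both `θ` and `k₁` cancel in `2 S(e, ∂_k) - T(e, e, ∂_k)`. The gradient of `t` is therefore a
multiple of `b`, with a factor `1 + k₂ t - k₃ t²` that cancels the denominators met in
differentiating the deformation. -/
theorem HasFlatJet.pd_normSq (hU : IsOpen U) (ha : IsRiemannianMetricOn U a)
    (hb : IsOneFormOn U b) (hx : x ∈ U) {θ : (Fin n → ℝ) →ₗ[ℝ] ℝ} {m : ℝ}
    (h : HasFlatJet k₁ k₂ k₃ (form2 (a x)) (form1 (b x)) (form2 (formJet b x))
      (form3 (metricJet a x)) θ m) (k : Fin n) :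
    pd k (normSq a b) x = 4 * m * deformQ k₂ k₃ (normSq a b x) * b x k := by
  have hp := ha.posDef x hx
  rw [AlphaBeta.pd_normSq hU ha hb hx, h.1, h.2]
  simp only [form2_raise_left hp, ← normSq_eq_form1, form1_single, deformQ]
  ring

/-- The pair `(a', b')` is the deformation of `(a, b)` with factor `f`, `t` being the squared norm
of `b` with respect to `a`:
`f(t)² a' = a + (k₂ - k₃ t) b ⊗ b` and `f(t) b' = -√(1 + k₂ t - k₃ t²) b`. -/
structure IsDeformedOn (k₁ k₂ k₃ : ℝ) (f : ℝ → ℝ) (U : Set (Fin n → ℝ))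
    (a : (Fin n → ℝ) → Matrix (Fin n) (Fin n) ℝ) (b : (Fin n → ℝ) → Fin n → ℝ)
    (a' : (Fin n → ℝ) → Matrix (Fin n) (Fin n) ℝ) (b' : (Fin n → ℝ) → Fin n → ℝ) : Prop where
  isOpen : IsOpen U
  metric : IsRiemannianMetricOn U a
  form : IsOneFormOn U b
  metric' : IsRiemannianMetricOn U a'
  form' : IsOneFormOn U b'
  factor : ∀ x ∈ U, IsFactorAt k₁ k₂ k₃ f (normSq a b x)
  pos : ∀ x ∈ U, 0 < deformQ k₂ k₃ (normSq a b x)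
  metric_eq : ∀ x ∈ U, ∀ i j, f (normSq a b x) ^ 2 * a' x i j
    = a x i j + (k₂ - k₃ * normSq a b x) * (b x i * b x j)
  form_eq : ∀ x ∈ U, ∀ i, f (normSq a b x) * b' x i = -(√(deformQ k₂ k₃ (normSq a b x)) * b x i)

/-- With `κ = k₂ - k₃ t` one has `1 + κ t = 1 + k₂ t - k₃ t²`, which cancels the square of the
factor `√(1 + k₂ t - k₃ t²)` in the new form; the powers of `f` cancel as well. -/
theorem IsDeformedOn.normSq_eq {f : ℝ → ℝ} (h : IsDeformedOn k₁ k₂ k₃ f U a b a' b')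
    (hx : x ∈ U) : normSq a' b' x = normSq a b x := by
  have hf := (h.factor x hx).1
  have hQ := h.pos x hx
  set t := normSq a b x with ht
  have hk : 1 + (k₂ - k₃ * t) * t = deformQ k₂ k₃ t := by rw [deformQ]; ring
  have := normSq_rankOne (a := a) (a' := a') (b := b) (b' := b') (l := 1 / f t ^ 2)
    (κ := k₂ - k₃ * t) (μ := -(√(deformQ k₂ k₃ t) / f t)) (h.metric.posDef x hx)
    (h.metric'.posDef x hx)
    (fun i j => by
      have := h.metric_eq x hx i j
      rw [← ht] at this
      field_simp
      linear_combination this)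
    (fun i => by have := h.form_eq x hx i; field_simp; linear_combination this)
    (by positivity) (by rw [← ht, hk]; exact hQ.ne')
  rw [this, ← ht, hk, neg_sq, div_pow, Real.sq_sqrt hQ.le]
  field_simp

theorem IsDeformedOn.formJet_eq {f : ℝ → ℝ} (h : IsDeformedOn k₁ k₂ k₃ f U a b a' b')
    (hx : x ∈ U) (i k : Fin n) :
    f (normSq a b x) * formJet b' x i k
      + b' x i * (f (normSq a b x) * ((k₁ - k₂ + k₃ * normSq a b x)
        / (4 * deformQ k₂ k₃ (normSq a b x))) * pd k (normSq a b) x)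
    = -(√(deformQ k₂ k₃ (normSq a b x)) * formJet b x i k
      + b x i * ((k₂ - 2 * k₃ * normSq a b x) / (2 * √(deformQ k₂ k₃ (normSq a b x)))
        * pd k (normSq a b) x)) := by
  have hU := h.isOpen
  have hdt := differentiableAt_of_smoothOn hU (smoothOn_normSq h.metric h.form) hx
  have hdb := differentiableAt_of_smoothOn hU (h.form i) hx
  have hdb' := differentiableAt_of_smoothOn hU (h.form' i) hx
  have hf := (h.factor x hx).2.2
  have hr := (hasDerivAt_deformQ (k₂ := k₂) (k₃ := k₃) (t := normSq a b x)).sqrt (h.pos x hx).ne'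
  have hev : (fun x => f (normSq a b x) * b' x i) =ᶠ[nhds x]
      fun x => -1 * (√(deformQ k₂ k₃ (normSq a b x)) * b x i) := by
    filter_upwards [hU.mem_nhds hx] with x' hx'
    rw [h.form_eq x' hx']; ring
  have hdf : DifferentiableAt ℝ (fun x => f (normSq a b x)) x :=
    (hf.differentiableAt).comp x hdt
  have hdr : DifferentiableAt ℝ (fun x => √(deformQ k₂ k₃ (normSq a b x))) x :=
    (hr.differentiableAt).comp x hdt
  have := pd_congr (k := k) hev
  rw [pd_mul hdf hdb', pd_const_mul (hdr.fun_mul hdb), pd_mul hdr hdb,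
    pd_comp hf hdt, pd_comp (F := fun t => √(deformQ k₂ k₃ t)) hr hdt] at this
  rw [formJet_apply, formJet_apply, this]
  ring

theorem IsDeformedOn.metricJet_eq {f : ℝ → ℝ} (h : IsDeformedOn k₁ k₂ k₃ f U a b a' b')
    (hx : x ∈ U) (i j k : Fin n) :
    f (normSq a b x) ^ 2 * metricJet a' x i j k
      + a' x i j * (2 * f (normSq a b x) ^ 2 * ((k₁ - k₂ + k₃ * normSq a b x)
        / (4 * deformQ k₂ k₃ (normSq a b x))) * pd k (normSq a b) x)
    = metricJet a x i j k
      + (k₂ - k₃ * normSq a b x) * (b x i * formJet b x j k + b x j * formJet b x i k)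
      - k₃ * pd k (normSq a b) x * (b x i * b x j) := by
  have hU := h.isOpen
  have hdt := differentiableAt_of_smoothOn hU (smoothOn_normSq h.metric h.form) hx
  have hdb := fun i => differentiableAt_of_smoothOn hU (h.form i) hx
  have hda := differentiableAt_of_smoothOn hU (h.metric.smooth i j) hx
  have hda' := differentiableAt_of_smoothOn hU (h.metric'.smooth i j) hx
  have hf := (h.factor x hx).2.2
  have hr : HasDerivAt (fun t => k₂ - k₃ * t) (-k₃) (normSq a b x) := by
    simpa using ((hasDerivAt_id (normSq a b x)).const_mul k₃).const_sub k₂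
  have hev : (fun x => f (normSq a b x) ^ 2 * a' x i j) =ᶠ[nhds x]
      fun x => a x i j + (k₂ - k₃ * normSq a b x) * (b x i * b x j) := by
    filter_upwards [hU.mem_nhds hx] with x' hx'
    rw [h.metric_eq x' hx']
  have hdf : DifferentiableAt ℝ (fun x => f (normSq a b x) ^ 2) x :=
    ((hf.differentiableAt).comp x hdt).pow 2
  have hdr : DifferentiableAt ℝ (fun x => k₂ - k₃ * normSq a b x) x :=
    (hr.differentiableAt).comp x hdt
  have hdbb := (hdb i).fun_mul (hdb j)
  have := pd_congr (k := k) hev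
  rw [pd_mul hdf hda', pd_add hda (hdr.fun_mul hdbb), pd_mul hdr hdbb, pd_mul (hdb i) (hdb j),
    pd_comp (F := fun t => f t ^ 2) (hf.fun_pow 2) hdt,
    pd_comp (F := fun t => k₂ - k₃ * t) hr hdt] at this
  rw [formJet_apply, formJet_apply, metricJet, metricJet]
  linear_combination this

/-- The derivatives of a deformation when `∂_k t = 4 m (1 + k₂ t - k₃ t²) b_k`. -/
theorem IsDeformedOn.jets {f : ℝ → ℝ} (h : IsDeformedOn k₁ k₂ k₃ f U a b a' b')
    (hx : x ∈ U) {m : ℝ}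
    (ht : ∀ k, pd k (normSq a b) x = 4 * m * deformQ k₂ k₃ (normSq a b x) * b x k) :
    (∀ i k, f (normSq a b x) * formJet b' x i k
      = -(√(deformQ k₂ k₃ (normSq a b x)) * (formJet b x i k
        - m * (k₁ - 3 * k₂ + 5 * k₃ * normSq a b x) * (b x i * b x k)))) ∧
    (∀ i j k, f (normSq a b x) ^ 2 * metricJet a' x i j k
      = metricJet a x i j k
        + (k₂ - k₃ * normSq a b x) * (b x i * formJet b x j k + b x j * formJet b x i k)
        - 4 * m * k₃ * deformQ k₂ k₃ (normSq a b x) * (b x i * b x j * b x k)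
        - 2 * m * (k₁ - k₂ + k₃ * normSq a b x) * b x k
          * (a x i j + (k₂ - k₃ * normSq a b x) * (b x i * b x j))) := by
  have hQ := h.pos x hx
  have hr := Real.sqrt_pos.2 hQ
  have hr2 := Real.sq_sqrt hQ.le
  have jS := h.formJet_eq hx
  have jT := h.metricJet_eq hx
  have ea := h.metric_eq x hx
  have eb := h.form_eq x hx
  simp only [ht] at jS jT
  generalize normSq a b x = t at *
  generalize hQd : deformQ k₂ k₃ t = Q at *
  have hc : ∀ k, (k₁ - k₂ + k₃ * t) / (4 * Q) * (4 * m * Q * b x k)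
      = (k₁ - k₂ + k₃ * t) * m * b x k := by
    intro k; field_simp
  have hd : ∀ k, (k₂ - 2 * k₃ * t) / (2 * √Q) * (4 * m * Q * b x k)
      = 2 * (k₂ - 2 * k₃ * t) * m * √Q * b x k := by
    intro k
    nth_rewrite 2 [← hr2]
    field_simp
    ring
  constructor
  · intro i k
    have := jS i k
    rw [mul_assoc (f t), hc, hd] at this
    linear_combination this - (k₁ - k₂ + k₃ * t) * m * b x k * eb i
  · intro i j k
    have := jT i j k
    rw [mul_assoc (2 * f t ^ 2), hc] at this
    linear_combination this - 2 * (k₁ - k₂ + k₃ * t) * m * b x k * ea i j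

/-- In `f² ∂_k a'_ij`, the `a`-terms of `S` contribute `2 m (k₂ - k₃ t)` times `b_i a_jk + b_j
a_ik`. The logarithmic derivative of `f` changes `2 m k₁ b_k a_ij` into `2 m (k₂ - k₃ t) b_k a_ij`,
the missing third summand. All three are absorbed in `θ' = θ + (k₂ - k₃ t) m b / 2`. -/
theorem IsDeformedOn.hasDualJetAt {f : ℝ → ℝ} (h : IsDeformedOn k₁ k₂ k₃ f U a b a' b')
    (hx : x ∈ U) {θ : (Fin n → ℝ) →ₗ[ℝ] ℝ} {m : ℝ}
    (hj : HasFlatJet k₁ k₂ k₃ (form2 (a x)) (form1 (b x)) (form2 (formJet b x))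
      (form3 (metricJet a x)) θ m) :
    ∃ θ' c, HasDualJetAt a' b' x θ' c := by
  have hf := (h.factor x hx).1
  obtain ⟨jS, jT⟩ := h.jets hx (hj.pd_normSq h.isOpen h.metric h.form hx)
  have ea := h.metric_eq x hx
  have eb := h.form_eq x hx
  have hT : ∀ i j k, metricJet a x i j k = 4 * (θ (Pi.single i 1) * a x j k
      + θ (Pi.single j 1) * a x i k + θ (Pi.single k 1) * a x i j)
      + 2 * m * (k₁ * b x k * a x i j + 2 * k₃ * b x i * b x j * b x k) := by
    intro i j k
    have := hj.1 (Pi.single i 1) (Pi.single j 1) (Pi.single k 1)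
    simpa only [form3_single, form2_single, form1_single] using this
  have hS : ∀ i j, formJet b x i j = 4 * θ (Pi.single i 1) * b x j + 2 * θ (Pi.single j 1) * b x i
      + m * (2 * a x i j + (k₁ + 2 * k₂) * b x i * b x j) := by
    intro i j
    have := hj.2 (Pi.single i 1) (Pi.single j 1)
    simpa only [form2_single, form1_single] using this
  generalize normSq a b x = t at *
  have hQd : deformQ k₂ k₃ t = 1 + k₂ * t - k₃ * t ^ 2 := rfl
  refine ⟨fun i => θ (Pi.single i 1) + (k₂ - k₃ * t) / 2 * m * b x i,
    -2 * m * √(deformQ k₂ k₃ t) * f t, fun i j k => ?_, fun i j => ?_⟩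
  · have := jT i j k
    rw [hT, hS, hS, hQd] at this
    refine mul_left_cancel₀ (pow_pos hf 2).ne' ?_
    linear_combination this - 4 * (θ (Pi.single i 1) + (k₂ - k₃ * t) / 2 * m * b x i) * ea j k
      - 4 * (θ (Pi.single j 1) + (k₂ - k₃ * t) / 2 * m * b x j) * ea i k
      - 4 * (θ (Pi.single k 1) + (k₂ - k₃ * t) / 2 * m * b x k) * ea i j
  · have := jS i j
    rw [hS] at this
    refine mul_left_cancel₀ hf.ne' ?_
    linear_combination this - 4 * (θ (Pi.single i 1) + (k₂ - k₃ * t) / 2 * m * b x i) * eb j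
      - 2 * (θ (Pi.single j 1) + (k₂ - k₃ * t) / 2 * m * b x j) * eb i
      + 2 * m * √(deformQ k₂ k₃ t) * ea i j

/-- The substitution of the direct statement, solved for `m` and `θ`. The gradient of `t`, needed
before the jet of `(a, b)` is known, is computed on the side of `(a', b')`, where the squared norm
is the same. -/
theorem IsDeformedOn.exists_hasFlatJet {f : ℝ → ℝ} (h : IsDeformedOn k₁ k₂ k₃ f U a b a' b')
    (hx : x ∈ U) {θ' : Fin n → ℝ} {c : ℝ} (hj : HasDualJetAt a' b' x θ' c) :
    ∃ θ m, HasFlatJet k₁ k₂ k₃ (form2 (a x)) (form1 (b x)) (form2 (formJet b x))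
      (form3 (metricJet a x)) θ m := by
  have hf := (h.factor x hx).1
  have hQ := h.pos x hx
  have hr := Real.sqrt_pos.2 hQ
  have hr2 := Real.sq_sqrt hQ.le
  have eb := h.form_eq x hx
  obtain ⟨m, hm⟩ : ∃ m, c = -2 * m * √(deformQ k₂ k₃ (normSq a b x)) * f (normSq a b x) :=
    ⟨-c / (2 * √(deformQ k₂ k₃ (normSq a b x)) * f (normSq a b x)), by field_simp⟩
  have ht : ∀ k, pd k (normSq a b) x = 4 * m * deformQ k₂ k₃ (normSq a b x) * b x k := by
    intro k
    have hev : normSq a b =ᶠ[nhds x] normSq a' b' := by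
      filter_upwards [h.isOpen.mem_nhds hx] with x' hx'
      exact (h.normSq_eq hx').symm
    rw [pd_congr hev, hj.pd_normSq h.isOpen h.metric' h.form' hx, hm]
    linear_combination -4 * m * √(deformQ k₂ k₃ (normSq a b x)) * eb k + 4 * m * b x k * hr2
  obtain ⟨jS, jT⟩ := h.jets hx ht
  have ea := h.metric_eq x hx
  rw [HasDualJetAt, hm] at hj
  have hsymm := h.metric.symm hx
  generalize normSq a b x = t at *
  have hQd : deformQ k₂ k₃ t = 1 + k₂ * t - k₃ * t ^ 2 := rfl
  have hS : ∀ i j, formJet b x i j = 4 * (θ' i - (k₂ - k₃ * t) / 2 * m * b x i) * b x j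
      + 2 * (θ' j - (k₂ - k₃ * t) / 2 * m * b x j) * b x i
      + m * (2 * a x i j + (k₁ + 2 * k₂) * b x i * b x j) := by
    intro i j
    have := jS i j
    rw [hj.2] at this
    refine mul_left_cancel₀ hr.ne' ?_
    linear_combination this - 4 * θ' i * eb j - 2 * θ' j * eb i
      + 2 * m * √(deformQ k₂ k₃ t) * ea i j
  refine ⟨_, m, hasFlatJet_of_coefficients (θ := fun i => θ' i - (k₂ - k₃ * t) / 2 * m * b x i)
    (fun i j k => ?_) hS hsymm⟩
  have := jT i j k
  rw [hj.1, hS, hS, hQd] at this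
  linear_combination -this + 4 * θ' i * ea j k + 4 * θ' j * ea i k + 4 * θ' k * ea i j

end Deformation

/-! ### Unique continuation for overdetermined linear systems -/

section LinearSystems

variable {n : ℕ} {ι : Type*} [Fintype ι] {U : Set (Fin n → ℝ)} {w : ι → (Fin n → ℝ) → ℝ}

theorem fderiv_eq_sum_pd (f : (Fin n → ℝ) → ℝ) (x v : Fin n → ℝ) :
    fderiv ℝ f x v = ∑ k, v k * pd k f x := by
  conv_lhs => rw [← Finset.univ_sum_single v]
  rw [map_sum]
  refine Finset.sum_congr rfl fun k _ => ?_
  have : (Pi.single k (v k) : Fin n → ℝ) = v k • Pi.single k 1 := by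
    rw [← Pi.single_smul]; simp
  rw [this, map_smul, pd, smul_eq_mul]

/-- A solution of a linear system `∂_k w_i = Λ_kij w_j` on a convex set vanishes if it vanishes at
a point. -/
theorem eq_zero_of_linear_system_of_convex (hc : Convex ℝ U)
    (hw : ∀ i, ∀ x ∈ U, DifferentiableAt ℝ (w i) x) {Λ : Fin n → ι → ι → (Fin n → ℝ) → ℝ}
    (hΛ : ∀ k i j, ContinuousOn (Λ k i j) U)
    (h : ∀ x ∈ U, ∀ k i, pd k (w i) x = ∑ j, Λ k i j x * w j x) {x₀ x : Fin n → ℝ}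
    (hx₀ : x₀ ∈ U) (hx : x ∈ U) (h0 : ∀ i, w i x₀ = 0) (i : ι) : w i x = 0 := by
  set γ : ℝ → Fin n → ℝ := fun s => x₀ + s • (x - x₀) with hγ
  have hγU : ∀ s ∈ Set.Icc (0 : ℝ) 1, γ s ∈ U := fun s hs =>
    hc.add_smul_sub_mem hx₀ hx hs
  have hγd : ∀ s, HasDerivAt γ (x - x₀) s := by
    intro s
    have h1 : HasDerivAt γ _ s := ((hasDerivAt_id s).smul_const (x - x₀)).const_add x₀
    exact h1.congr_deriv (one_smul _ _)
  have hγc : Continuous γ := continuous_iff_continuousAt.2 fun s => (hγd s).continuousAt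
  set g : ℝ → ι → ℝ := fun s i => w i (γ s) with hg
  set g' : ℝ → ι → ℝ := fun s i => ∑ k, (x - x₀) k * ∑ j, Λ k i j (γ s) * w j (γ s) with hg'
  have hgd : ∀ s ∈ Set.Icc (0 : ℝ) 1, HasDerivAt g (g' s) s := by
    intro s hs
    refine hasDerivAt_pi.2 fun i => ?_
    have h1 := (hw i _ (hγU s hs)).hasFDerivAt.comp_hasDerivAt s (hγd s)
    refine h1.congr_deriv ?_
    rw [fderiv_eq_sum_pd]
    exact Finset.sum_congr rfl fun k _ => by rw [h _ (hγU s hs)]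
  have hcont : ContinuousOn (fun s => ∑ i, ∑ k, ∑ j, |(x - x₀) k * Λ k i j (γ s)|)
      (Set.Icc (0 : ℝ) 1) := by
    refine continuousOn_finsetSum _ fun i _ => continuousOn_finsetSum _ fun k _ =>
      continuousOn_finsetSum _ fun j _ => ContinuousOn.abs (continuousOn_const.mul ?_)
    exact (hΛ k i j).comp hγc.continuousOn hγU
  obtain ⟨K, hK⟩ := isCompact_Icc.bddAbove_image hcont
  -- `K` bounds the sum of the absolute values of all coefficients on the segment, so Grönwall's
  -- inequality applies to the restriction of `w` to it.
  have hbound : ∀ s ∈ Set.Icc (0 : ℝ) 1, ‖g' s‖ ≤ K * ‖g s‖ := by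
    intro s hs
    have hKs : ∑ i, ∑ k, ∑ j, |(x - x₀) k * Λ k i j (γ s)| ≤ K := hK ⟨s, hs, rfl⟩
    have hK0 : 0 ≤ K := le_trans (by positivity) hKs
    refine (pi_norm_le_iff_of_nonneg (by positivity)).2 fun i => ?_
    have h1 : ‖g' s i‖ ≤ ∑ k, ∑ j, |(x - x₀) k * Λ k i j (γ s)| * ‖g s‖ := by
      simp only [hg', Finset.mul_sum]
      refine (norm_sum_le _ _).trans (Finset.sum_le_sum fun k _ =>
        (norm_sum_le _ _).trans (Finset.sum_le_sum fun j _ => ?_))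
      rw [← mul_assoc, norm_mul, Real.norm_eq_abs]
      exact mul_le_mul_of_nonneg_left (norm_le_pi_norm (g s) j) (abs_nonneg _)
    simp only [← Finset.sum_mul] at h1
    refine h1.trans (mul_le_mul_of_nonneg_right (le_trans ?_ hKs) (norm_nonneg _))
    exact Finset.single_le_sum (f := fun i => ∑ k, ∑ j, |(x - x₀) k * Λ k i j (γ s)|)
      (fun i _ => by positivity) (Finset.mem_univ i)
  have key := eq_zero_of_abs_deriv_le_mul_abs_self_of_eq_zero_right (f := g) (f' := g')
    (K := K) (a := 0) (b := 1)
    (fun s hs => (hgd s hs).continuousAt.continuousWithinAt)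
    (fun s hs => (hgd s (Set.Ico_subset_Icc_self hs)).hasDerivWithinAt)
    (by ext i; simpa [hg, hγ] using h0 i)
    (fun s hs => hbound s (Set.Ico_subset_Icc_self hs)) 1 (by simp)
  have := congrFun key i
  simpa [hg, hγ] using this

/-- On a small ball the convex case applies, so every zero in `U` is interior to the zero set. By
continuity the limits in `U` of such points are zeros too, and connectedness concludes. -/
theorem eq_zero_of_linear_system (hU : IsOpen U)
    (hw : ∀ i, ContDiffOn ℝ ∞ (w i) U) {Λ : Fin n → ι → ι → (Fin n → ℝ) → ℝ}
    (hΛ : ∀ k i j, ContinuousOn (Λ k i j) U)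
    (h : ∀ x ∈ U, ∀ k i, pd k (w i) x = ∑ j, Λ k i j x * w j x) {x₀ : Fin n → ℝ}
    (hx₀ : x₀ ∈ U) (h0 : ∀ i, w i x₀ = 0) :
    ∀ x ∈ connectedComponentIn U x₀, ∀ i, w i x = 0 := by
  have hloc : ∀ x ∈ U, (∀ i, w i x = 0) → x ∈ interior {x | ∀ i, w i x = 0} := by
    intro x hx hx0
    obtain ⟨r, hr, hrU⟩ := Metric.isOpen_iff.1 hU x hx
    refine mem_interior.2 ⟨Metric.ball x r, fun y hy i => ?_, Metric.isOpen_ball,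
      Metric.mem_ball_self hr⟩
    exact eq_zero_of_linear_system_of_convex (convex_ball x r)
      (fun i z hz => differentiableAt_of_smoothOn hU (hw i) (hrU hz))
      (fun k i j => (hΛ k i j).mono hrU) (fun z hz => h z (hrU hz))
      (Metric.mem_ball_self hr) hy hx0 i
  have hsub := (isPreconnected_connectedComponentIn (F := U) (x := x₀)).subset_of_closure_inter_subset
    (isOpen_interior (s := {x | ∀ i, w i x = 0}))
    ⟨x₀, mem_connectedComponentIn hx₀, hloc x₀ hx₀ h0⟩ ?_
  · exact fun x hx => interior_subset (hsub hx)
  · rintro x ⟨hxc, hxV⟩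
    have hxU := connectedComponentIn_subset U x₀ hxV
    refine hloc x hxU fun i => ?_
    have hcl : x ∈ closure {x | ∀ i, w i x = 0} := closure_mono interior_subset hxc
    have hci : ContinuousAt (w i) x := (differentiableAt_of_smoothOn hU (hw i) hxU).continuousAt
    by_contra hne
    obtain ⟨y, hy1, hy2⟩ := mem_closure_iff_nhds.1 hcl _ (hci.eventually_ne hne)
    exact hy1 (hy2 i)

/-- `E` is a linear combination of the `w_j` with continuous coefficients on `U`. -/
def IsLinearIn (U : Set (Fin n → ℝ)) (w : ι → (Fin n → ℝ) → ℝ) (E : (Fin n → ℝ) → ℝ) : Prop :=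
  ∃ Λ : ι → (Fin n → ℝ) → ℝ, (∀ j, ContinuousOn (Λ j) U) ∧ ∀ x ∈ U, E x = ∑ j, Λ j x * w j x

theorem IsLinearIn.base (j : ι) : IsLinearIn U w (w j) := by
  classical
  exact ⟨fun i _ => if i = j then 1 else 0, fun _ => continuousOn_const, fun x _ => by simp⟩

theorem IsLinearIn.add {E F : (Fin n → ℝ) → ℝ} (hE : IsLinearIn U w E) (hF : IsLinearIn U w F) :
    IsLinearIn U w (fun x => E x + F x) := by
  obtain ⟨Λ, h1, h2⟩ := hE
  obtain ⟨M, h3, h4⟩ := hF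
  exact ⟨fun j x => Λ j x + M j x, fun j => (h1 j).add (h3 j), fun x hx => by
    beta_reduce
    rw [h2 x hx, h4 x hx, ← Finset.sum_add_distrib]
    exact Finset.sum_congr rfl fun j _ => by ring⟩

theorem IsLinearIn.mul {E c : (Fin n → ℝ) → ℝ} (hE : IsLinearIn U w E) (hc : ContinuousOn c U) :
    IsLinearIn U w (fun x => c x * E x) := by
  obtain ⟨Λ, h1, h2⟩ := hE
  exact ⟨fun j x => c x * Λ j x, fun j => hc.mul (h1 j), fun x hx => by
    beta_reduce
    rw [h2 x hx, Finset.mul_sum]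
    exact Finset.sum_congr rfl fun j _ => by ring⟩

theorem IsLinearIn.sub {E F : (Fin n → ℝ) → ℝ} (hE : IsLinearIn U w E) (hF : IsLinearIn U w F) :
    IsLinearIn U w (fun x => E x - F x) := by
  have := hE.add (hF.mul (c := fun _ => -1) continuousOn_const)
  simpa [sub_eq_add_neg] using this

theorem IsLinearIn.sum {κ : Type*} {s : Finset κ} {E : κ → (Fin n → ℝ) → ℝ}
    (hE : ∀ i, IsLinearIn U w (E i)) : IsLinearIn U w (fun x => ∑ i ∈ s, E i x) := by
  classical
  induction s using Finset.induction_on with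
  | empty => exact ⟨fun _ _ => 0, fun _ => continuousOn_const, fun x _ => by simp⟩
  | insert i s hi ih =>
    simp only [Finset.sum_insert hi]
    exact (hE i).add ih

theorem IsLinearIn.continuousOn {E : (Fin n → ℝ) → ℝ} (hE : IsLinearIn U w E)
    (hw : ∀ i, ContinuousOn (w i) U) : ContinuousOn E U := by
  obtain ⟨Λ, h1, h2⟩ := hE
  exact (continuousOn_finsetSum _ fun j _ => (h1 j).mul (hw j)).congr h2

theorem IsLinearIn.eq_zero {E : (Fin n → ℝ) → ℝ} (hE : IsLinearIn U w E) {x : Fin n → ℝ}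
    (hx : x ∈ U) (h0 : ∀ i, w i x = 0) : E x = 0 := by
  obtain ⟨Λ, _, h2⟩ := hE
  simp [h2 x hx, h0]

/-- Unique continuation across the zero set of a part of the unknowns. -/
theorem eq_zero_of_isLinearIn (hU : IsOpen U) (hw : ∀ i, ContDiffOn ℝ ∞ (w i) U)
    {E : Fin n → ι → (Fin n → ℝ) → ℝ} (hE : ∀ k i, IsLinearIn U w (E k i))
    {W : Set (Fin n → ℝ)} (hW : ∀ x ∈ U, x ∈ W → ∀ k i, pd k (w i) x = E k i x)
    (hZ : ∀ x ∈ U, x ∉ closure W → ∀ i, w i =ᶠ[nhds x] fun _ => 0)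
    {x₀ : Fin n → ℝ} (hx₀ : x₀ ∈ U) (hxW : x₀ ∉ closure W) :
    ∀ x ∈ connectedComponentIn U x₀, ∀ i, w i x = 0 := by
  -- The system extends from `W` to its closure by continuity; off the closure both sides are zero.
  have hall : ∀ x ∈ U, ∀ k i, pd k (w i) x = E k i x := by
    intro x hx k i
    by_cases hxc : x ∈ closure W
    · have c1 : ContinuousAt (fun x => pd k (w i) x) x :=
        (differentiableAt_of_smoothOn hU (smoothOn_pd hU (hw i) k) hx).continuousAt
      have c2 : ContinuousAt (E k i) x :=
        ((hE k i).continuousOn fun i => (hw i).continuousOn).continuousAt (hU.mem_nhds hx)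
      by_contra hne
      have hne' : ∀ᶠ y in nhds x, pd k (w i) y - E k i y ≠ 0 :=
        (c1.sub c2).eventually_ne (sub_ne_zero.2 hne)
      obtain ⟨y, hy1, hy2⟩ := mem_closure_iff_nhds.1 hxc _
        (Filter.inter_mem hne' (hU.mem_nhds hx))
      exact hy1.1 (sub_eq_zero.2 (hW y hy1.2 hy2 k i))
    · rw [pd_eventuallyEq_zero (hZ x hx hxc i),
        (hE k i).eq_zero hx fun i => (hZ x hx hxc i).self_of_nhds]
  choose Λ hΛ1 hΛ2 using hE
  exact eq_zero_of_linear_system hU hw (Λ := Λ) hΛ1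
    (fun x hx k i => by rw [hall x hx, hΛ2 k i x hx]) hx₀
    fun i => (hZ x₀ hx₀ hxW i).self_of_nhds

end LinearSystems

/-! ### Recovering `θ` and `c` as traces; the zeros of the form -/

section Traces

variable {n : ℕ} {U : Set (Fin n → ℝ)} {a : (Fin n → ℝ) → Matrix (Fin n) (Fin n) ℝ}
  {b : (Fin n → ℝ) → Fin n → ℝ} {x : Fin n → ℝ}

/-- The covector which a dual jet determines by its metric part. -/
def traceForm (a : (Fin n → ℝ) → Matrix (Fin n) (Fin n) ℝ) (x : Fin n → ℝ) (k : Fin n) : ℝ :=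
  1 / (4 * (n + 2)) * ∑ i, ∑ j, (a x)⁻¹ i j * metricJet a x i j k

/-- The number which a dual jet determines by its form part. -/
def traceScalar (a : (Fin n → ℝ) → Matrix (Fin n) (Fin n) ℝ) (b : (Fin n → ℝ) → Fin n → ℝ)
    (x : Fin n → ℝ) : ℝ :=
  1 / n * ∑ i, ∑ j, (a x)⁻¹ i j *
    (formJet b x i j - 4 * traceForm a x i * b x j - 2 * traceForm a x j * b x i)

theorem smoothOn_metricJet (hU : IsOpen U) (ha : IsRiemannianMetricOn U a) (i j k : Fin n) :
    ContDiffOn ℝ ∞ (fun x => metricJet a x i j k) U := smoothOn_pd hU (ha.smooth i j) k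

theorem smoothOn_formJet (hU : IsOpen U) (hb : IsOneFormOn U b) (i j : Fin n) :
    ContDiffOn ℝ ∞ (fun x => formJet b x i j) U := smoothOn_pd hU (hb i) j

theorem isOneFormOn_traceForm (hU : IsOpen U) (ha : IsRiemannianMetricOn U a) :
    IsOneFormOn U (traceForm a) := fun k =>
  contDiffOn_const.mul (ContDiffOn.sum fun i _ => ContDiffOn.sum fun j _ =>
    (ha.smoothOn_inv i j).mul (smoothOn_metricJet hU ha i j k))

theorem smoothOn_traceScalar (hU : IsOpen U) (ha : IsRiemannianMetricOn U a)
    (hb : IsOneFormOn U b) : ContDiffOn ℝ ∞ (traceScalar a b) U := by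
  have hθ := isOneFormOn_traceForm hU ha
  exact contDiffOn_const.mul (ContDiffOn.sum fun i _ => ContDiffOn.sum fun j _ =>
    (ha.smoothOn_inv i j).mul (((smoothOn_formJet hU hb i j).sub
      ((contDiffOn_const.mul (hθ i)).mul (hb j))).sub ((contDiffOn_const.mul (hθ j)).mul (hb i))))

theorem sum_inv_mul_metric (h : (a x).PosDef) :
    ∑ i, ∑ j, (a x)⁻¹ i j * a x i j = n := by
  have h1 : (a x)⁻¹ * a x = 1 := Matrix.nonsing_inv_mul _ h.det_pos.ne'.isUnit
  have h2 : ∀ i, ∑ j, (a x)⁻¹ i j * a x i j = 1 := by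
    intro i
    have := congrFun (congrFun h1 i) i
    rw [Matrix.mul_apply, Matrix.one_apply_eq] at this
    rw [← this]
    exact Finset.sum_congr rfl fun j _ => by rw [posDef_symm h i j]
  simp [h2]

theorem sum_inv_mul_mul_metric (h : (a x).PosDef) (ξ : Fin n → ℝ) (k : Fin n) :
    ∑ i, ∑ j, (a x)⁻¹ i j * (ξ i * a x j k) = ξ k := by
  have h1 : (a x)⁻¹ * a x = 1 := Matrix.nonsing_inv_mul _ h.det_pos.ne'.isUnit
  have h2 : ∀ i, ∑ j, (a x)⁻¹ i j * (ξ i * a x j k) = ξ i * (1 : Matrix (Fin n) (Fin n) ℝ) i k := by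
    intro i
    rw [← h1, Matrix.mul_apply, Finset.mul_sum]
    exact Finset.sum_congr rfl fun j _ => by ring
  simp [h2, Matrix.one_apply]

theorem sum_inv_mul_metric_mul (h : (a x).PosDef) (ξ : Fin n → ℝ) (k : Fin n) :
    ∑ i, ∑ j, (a x)⁻¹ i j * (ξ j * a x i k) = ξ k := by
  rw [← sum_inv_mul_mul_metric h ξ k, Finset.sum_comm]
  refine Finset.sum_congr rfl fun i _ => Finset.sum_congr rfl fun j _ => ?_
  rw [posDef_symm h.inv j i]

/-- Contracting the symmetrised product with `a⁻¹` gives `θ_k` twice and `n θ_k` once, hence the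
constant `4 (n + 2)`. -/
theorem HasDualJetAt.eq_traceForm (h : (a x).PosDef) {θ : Fin n → ℝ} {c : ℝ}
    (hj : HasDualJetAt a b x θ c) : traceForm a x = θ := by
  ext k
  have e : ∑ i, ∑ j, (a x)⁻¹ i j * metricJet a x i j k = 4 * (n + 2) * θ k := by
    have : ∀ i j, (a x)⁻¹ i j * metricJet a x i j k = 4 * ((a x)⁻¹ i j * (θ i * a x j k))
        + 4 * ((a x)⁻¹ i j * (θ j * a x i k)) + 4 * θ k * ((a x)⁻¹ i j * a x i j) := by
      intro i j; rw [hj.1]; ring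
    simp only [this, Finset.sum_add_distrib, ← Finset.mul_sum]
    rw [sum_inv_mul_mul_metric h, sum_inv_mul_metric_mul h, sum_inv_mul_metric h]
    ring
  rw [traceForm, e]
  field_simp

theorem HasDualJetAt.eq_traceScalar (hn : n ≠ 0) (h : (a x).PosDef) {θ : Fin n → ℝ} {c : ℝ}
    (hj : HasDualJetAt a b x θ c) : traceScalar a b x = c := by
  have : ∀ i j, (a x)⁻¹ i j *
      (formJet b x i j - 4 * traceForm a x i * b x j - 2 * traceForm a x j * b x i)
      = c * ((a x)⁻¹ i j * a x i j) := by
    intro i j; rw [hj.2, hj.eq_traceForm h]; ring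
  simp only [traceScalar, this, ← Finset.mul_sum]
  rw [sum_inv_mul_metric h]
  field_simp

/-- A `1`-form which is dually related to the metric wherever it does not vanish is zero on a
connected component as soon as it vanishes near a point of that component. -/
theorem form_eq_zero_of_hasDualJetAt (hn : 2 ≤ n) (hU : IsOpen U) (ha : IsRiemannianMetricOn U a)
    (hb : IsOneFormOn U b)
    (h : ∀ x ∈ U, b x ≠ 0 → HasDualJetAt a b x (traceForm a x) (traceScalar a b x))
    {x₀ : Fin n → ℝ} (hx₀ : x₀ ∈ U) (h0 : x₀ ∉ closure {x | x ∈ U ∧ b x ≠ 0}) :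
    ∀ x ∈ connectedComponentIn U x₀, b x = 0 := by
  set θ := traceForm a with hθ
  set c := traceScalar a b with hc
  have sθ : IsOneFormOn U θ := isOneFormOn_traceForm hU ha
  have sc : ContDiffOn ℝ ∞ c U := smoothOn_traceScalar hU ha hb
  set W := {x | x ∈ U ∧ b x ≠ 0} with hWd
  have hWo : IsOpen W := by
    have hbc : ContinuousOn b U := continuousOn_pi.2 fun i => (hb i).continuousOn
    exact hbc.isOpen_inter_preimage hU isOpen_ne
  -- The unknowns are `c` (index `none`) and the components `b_i`; `θ` counts as a known
  -- coefficient. `D` is the right-hand side for `∂_j b_i`, `R` is the part of `∂_k D_ij` free of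
  -- derivatives of `c`, and `E` is the resulting closed system.
  set w : Option (Fin n) → (Fin n → ℝ) → ℝ := fun o => o.elim c fun i x => b x i with hwd
  set D : Fin n → Fin n → (Fin n → ℝ) → ℝ := fun i j x =>
    4 * θ x i * b x j + 2 * θ x j * b x i + a x i j * c x with hD
  set R : Fin n → Fin n → Fin n → (Fin n → ℝ) → ℝ := fun i j k x =>
    4 * θ x i * D j k x + 4 * formJet θ x i k * b x j + 2 * θ x j * D i k x
      + 2 * formJet θ x j k * b x i + metricJet a x i j k * c x with hR
  set E : Fin n → Option (Fin n) → (Fin n → ℝ) → ℝ := fun k o =>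
    o.elim (fun x => ∑ i, ∑ j, (1 / ((n : ℝ) - 1) * (a x)⁻¹ i j) * (R i k j x - R i j k x))
      fun i => D i k with hEd
  have lb : ∀ i, IsLinearIn U w (fun x => b x i) := fun i => IsLinearIn.base (some i)
  have lc : IsLinearIn U w c := IsLinearIn.base none
  have lD : ∀ i j, IsLinearIn U w (D i j) := fun i j =>
    (((lb j).mul (continuousOn_const.mul (sθ i).continuousOn)).add
      ((lb i).mul (continuousOn_const.mul (sθ j).continuousOn))).add
      (lc.mul (ha.smooth i j).continuousOn)
  have lR : ∀ i j k, IsLinearIn U w (R i j k) := fun i j k =>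
    (((((lD j k).mul (continuousOn_const.mul (sθ i).continuousOn)).add
      ((lb j).mul (continuousOn_const.mul (smoothOn_formJet hU sθ i k).continuousOn))).add
      ((lD i k).mul (continuousOn_const.mul (sθ j).continuousOn))).add
      ((lb i).mul (continuousOn_const.mul (smoothOn_formJet hU sθ j k).continuousOn))).add
      (lc.mul (smoothOn_metricJet hU ha i j k).continuousOn)
  have lE : ∀ k o, IsLinearIn U w (E k o) := by
    rintro k (_ | i)
    · exact IsLinearIn.sum fun i => IsLinearIn.sum fun j => ((lR i k j).sub (lR i j k)).mul
        (continuousOn_const.mul (ha.smoothOn_inv i j).continuousOn)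
    · exact lD i k
  have hfD : ∀ x ∈ W, ∀ i j, formJet b x i j = D i j x := by
    intro x hx i j
    rw [(h x hx.1 hx.2).2, hD]; ring
  have hsys : ∀ x ∈ U, x ∈ W → ∀ k o, pd k (w o) x = E k o x := by
    rintro x hx hxW k (_ | i)
    · have dθ := fun i => differentiableAt_of_smoothOn hU (sθ i) hx
      have db := fun i => differentiableAt_of_smoothOn hU (hb i) hx
      have da := fun i j => differentiableAt_of_smoothOn hU (ha.smooth i j) hx
      have dc := differentiableAt_of_smoothOn hU sc hx
      have hpdD : ∀ i j k, pd k (D i j) x = R i j k x + a x i j * pd k c x := by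
        intro i j k
        have d1 := ((dθ i).const_mul 4).fun_mul (db j)
        have d2 := ((dθ j).const_mul 2).fun_mul (db i)
        have d3 := (da i j).fun_mul dc
        simp only [hD]
        rw [pd_add (d1.fun_add d2) d3, pd_add d1 d2, pd_mul ((dθ i).const_mul 4) (db j),
          pd_mul ((dθ j).const_mul 2) (db i), pd_mul (da i j) dc, pd_const_mul (dθ i),
          pd_const_mul (dθ j), ← formJet_apply, ← formJet_apply, ← formJet_apply, ← formJet_apply,
          hfD x hxW, hfD x hxW]
        simp only [hR, metricJet]
        ring
      -- Symmetry of the second derivatives of `b_i`, valid because `∂b = D` on an open set. Its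
      -- trace with `a⁻¹` has `n - 1` copies of `∂_k c` and so determines them for `n ≥ 2`.
      have hcomm : ∀ i j k, R i j k x + a x i j * pd k c x = R i k j x + a x i k * pd j c x := by
        intro i j k
        rw [← hpdD, ← hpdD]
        have ev : ∀ l, D i l =ᶠ[nhds x] fun x => pd l (fun x => b x i) x := by
          intro l
          filter_upwards [hWo.mem_nhds hxW] with y hy
          rw [← hfD y hy]; rfl
        rw [pd_congr (ev j), pd_congr (ev k)]
        exact pd_pd_comm hU (hb i) hx k j
      have hp := ha.posDef x hx
      have h1 : ∑ i, ∑ j, (a x)⁻¹ i j * (a x i j * pd k c x - pd j c x * a x i k)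
          = (n - 1) * pd k c x := by
        simp only [mul_sub, Finset.sum_sub_distrib]
        rw [sum_inv_mul_metric_mul hp (fun j => pd j c x) k]
        simp only [← mul_assoc, ← Finset.sum_mul]
        rw [sum_inv_mul_metric hp]
        ring
      have hn1 : (n : ℝ) - 1 ≠ 0 := by
        have : (2 : ℝ) ≤ n := by exact_mod_cast hn
        linarith
      change pd k c x = ∑ i, ∑ j, (1 / ((n : ℝ) - 1) * (a x)⁻¹ i j) * (R i k j x - R i j k x)
      have h2 : pd k c x = 1 / ((n : ℝ) - 1) * ((n - 1) * pd k c x) := by field_simp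
      rw [h2, ← h1, Finset.mul_sum]
      refine Finset.sum_congr rfl fun i _ => ?_
      rw [Finset.mul_sum]
      refine Finset.sum_congr rfl fun j _ => ?_
      linear_combination (1 / ((n : ℝ) - 1) * (a x)⁻¹ i j) * hcomm i j k
    · exact hfD x hxW i k
  have hbZ : ∀ x ∈ U, x ∉ closure W → ∀ᶠ y in nhds x, b y = 0 := by
    intro x hx hxW
    filter_upwards [hU.mem_nhds hx, isClosed_closure.isOpen_compl.mem_nhds hxW] with y hyU hyW
    by_contra hne
    exact hyW (subset_closure ⟨hyU, hne⟩)
  have hZ : ∀ x ∈ U, x ∉ closure W → ∀ o, w o =ᶠ[nhds x] fun _ => 0 := by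
    intro x hx hxW
    have hev := hbZ x hx hxW
    rintro (_ | i)
    -- `c` is a trace of the first jet of `b`, so it vanishes at points near which `b` vanishes
    -- identically.
    · filter_upwards [hev.eventually_nhds] with y hy
      have e1 : b y = 0 := hy.self_of_nhds
      have e2 : ∀ i j, formJet b y i j = 0 := fun i j =>
        pd_eventuallyEq_zero (hy.mono fun z hz => by simp [hz])
      change traceScalar a b y = 0
      simp [traceScalar, e1, e2]
    · filter_upwards [hev] with y hy
      change b y i = 0
      simp [hy]
  intro x hx
  ext i
  exact eq_zero_of_isLinearIn hU (by
    rintro (_ | i)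
    · exact sc
    · exact hb i) lE hsys hZ hx₀ h0 x hx (some i)

end Traces

/-! ### Existence of the deformation and both implications -/

section MainTheorem

variable {n : ℕ} {U : Set (Fin n → ℝ)} {a a' : (Fin n → ℝ) → Matrix (Fin n) (Fin n) ℝ}
  {b b' : (Fin n → ℝ) → Fin n → ℝ} {x : Fin n → ℝ} {k₁ k₂ k₃ : ℝ} {φ : ℝ → ℝ} {I : Set ℝ}

theorem form2_rankOne (M : Matrix (Fin n) (Fin n) ℝ) (ξ : Fin n → ℝ) (p q : ℝ) (y : Fin n → ℝ) :
    form2 (Matrix.of fun i j => p * M i j + q * (ξ i * ξ j)) y y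
      = p * form2 M y y + q * form1 ξ y ^ 2 := by
  have : form2 (Matrix.of fun i j => p * M i j + q * (ξ i * ξ j))
      = p • form2 M + q • (form1 ξ).smulRight (form1 ξ) := by
    refine linearMap_ext2 fun i j => ?_
    simp
  rw [this]
  simp only [LinearMap.add_apply, LinearMap.smul_apply, LinearMap.smulRight_apply, smul_eq_mul]
  ring

theorem isRiemannianOn_of_form_eq_zero {V : Set (Fin n → ℝ)} (ha : IsRiemannianMetricOn V a)
    (hφ : 0 < φ 0) (hb : ∀ x ∈ V, b x = 0) : IsRiemannianOn V (alphaBetaFun φ a b) := by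
  refine ⟨fun x => φ 0 ^ 2 • a x, ⟨fun i j => ?_, fun x hx => ?_⟩, fun x hx y => ?_⟩
  · simpa only [Matrix.smul_apply, smul_eq_mul] using contDiffOn_const.mul (ha.smooth i j)
  · exact (ha.posDef x hx).smul (by positivity)
  · have h1 : form2 (φ 0 ^ 2 • a x) y y = φ 0 ^ 2 * form2 (a x) y y := by
      rw [form2_apply, form2_apply, Finset.mul_sum]
      refine Finset.sum_congr rfl fun i _ => ?_
      rw [Finset.mul_sum]
      exact Finset.sum_congr rfl fun j _ => by rw [Matrix.smul_apply, smul_eq_mul, mul_assoc]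
    rw [alphaBetaFun, alpha_eq, alpha_eq, h1, Real.sqrt_mul (by positivity), Real.sqrt_sq hφ.le,
      beta, hb x hx, zero_dotProduct, zero_div, mul_comm]

theorem smoothOn_factor_comp {f : ℝ → ℝ} (hU : IsOpen U) (ha : IsRiemannianMetricOn U a)
    (hb : IsOneFormOn U b) (hf : ∀ x ∈ U, ContDiffAt ℝ ∞ f (normSq a b x)) :
    ContDiffOn ℝ ∞ (fun x => f (normSq a b x)) U := fun x hx =>
  ((hf x hx).comp x ((smoothOn_normSq ha hb).contDiffAt (hU.mem_nhds hx))).contDiffWithinAt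

/-- Every admissible pair `(a, b)` has a deformation. -/
theorem exists_isDeformedOn {f : ℝ → ℝ} (hU : IsOpen U) (ha : IsRiemannianMetricOn U a)
    (hb : IsOneFormOn U b) (hf : ∀ x ∈ U, IsFactorAt k₁ k₂ k₃ f (normSq a b x))
    (hQ : ∀ x ∈ U, 0 < deformQ k₂ k₃ (normSq a b x)) :
    ∃ a' b', IsDeformedOn k₁ k₂ k₃ f U a b a' b' := by
  have sf := smoothOn_factor_comp hU ha hb fun x hx => (hf x hx).2.1
  have st := smoothOn_normSq ha hb
  have sr : ContDiffOn ℝ ∞ (fun x => √(deformQ k₂ k₃ (normSq a b x))) U :=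
    (contDiff_deformQ.comp_contDiffOn st).sqrt fun x hx => (hQ x hx).ne'
  have hf0 : ∀ x ∈ U, f (normSq a b x) ≠ 0 := fun x hx => (hf x hx).1.ne'
  refine ⟨fun x => Matrix.of fun i j => (1 / f (normSq a b x) ^ 2) * a x i j
      + ((k₂ - k₃ * normSq a b x) / f (normSq a b x) ^ 2) * (b x i * b x j),
    fun x i => -(√(deformQ k₂ k₃ (normSq a b x)) / f (normSq a b x)) * b x i,
    { isOpen := hU, metric := ha, form := hb, factor := hf, pos := hQ, metric' := ⟨?_, ?_⟩,
      form' := ?_, metric_eq := ?_, form_eq := ?_ }⟩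
  · intro i j
    simp only [Matrix.of_apply]
    exact ((contDiffOn_const.div (sf.pow 2) fun x hx => pow_ne_zero 2 (hf0 x hx)).mul
      (ha.smooth i j)).add (((contDiffOn_const.sub (contDiffOn_const.mul st)).div (sf.pow 2)
      fun x hx => pow_ne_zero 2 (hf0 x hx)).mul ((hb i).mul (hb j)))
  · intro x hx
    refine posDef_of_form2_pos (fun i j => ?_) fun v hv => ?_
    · simp only [Matrix.of_apply, ha.symm hx i j, mul_comm (b x i)]
    · have h1 := posDef_form2_pos (ha.posDef x hx) v hv
      have h2 := form1_sq_le (b := b) (ha.posDef x hx) v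
      have h3 := hQ x hx
      have h4 := (hf x hx).1
      rw [form2_rankOne]
      set t := normSq a b x
      -- For a negative coefficient, Cauchy–Schwarz bounds the sum below by `(1 + k₂ t - k₃ t²) α²`.
      have h5 : 0 < form2 (a x) v v + (k₂ - k₃ * t) * form1 (b x) v ^ 2 := by
        rcases le_or_gt 0 (k₂ - k₃ * t) with hh | hh
        · positivity
        · have h6 : 0 < deformQ k₂ k₃ t * form2 (a x) v v := mul_pos h3 h1
          have h7 := mul_le_mul_of_nonpos_left h2 hh.le
          rw [deformQ] at h6
          linarith
      have : 1 / f t ^ 2 * form2 (a x) v v + (k₂ - k₃ * t) / f t ^ 2 * form1 (b x) v ^ 2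
          = (form2 (a x) v v + (k₂ - k₃ * t) * form1 (b x) v ^ 2) / f t ^ 2 := by ring
      rw [this]
      positivity
  · intro i
    exact (sr.div sf hf0).neg.mul (hb i)
  · intro x hx i j
    have := hf0 x hx
    simp only [Matrix.of_apply]
    field_simp
  · intro x hx i
    have := hf0 x hx
    field_simp

theorem IsDeformedOn.isDeformationOn (h : IsDeformedOn k₁ k₂ k₃ (eta k₁ k₂ k₃) U a b a' b')
    (hadm : ∀ x ∈ U, Admissible k₂ k₃ (normSq a b x)) :
    IsDeformationOn k₁ k₂ k₃ U a b a' b' := by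
  intro x hx
  have hf := (h.factor x hx).1
  have hQ := h.pos x hx
  have ea := h.metric_eq x hx
  have eb := h.form_eq x hx
  have hd := hadm x hx
  have hp' := h.metric'.posDef x hx
  rw [h.normSq_eq hx]
  refine ⟨hd, fun y => ?_⟩
  generalize normSq a b x = t at *
  generalize eta k₁ k₂ k₃ t = f at *
  generalize deformQ k₂ k₃ t = Q at *
  have hr := Real.sqrt_pos.2 hQ
  have hr2 := Real.sq_sqrt hQ.le
  have hB : √Q * form1 (b x) y = -(f * form1 (b' x) y) := by
    rw [form1_apply, form1_apply, Finset.mul_sum, Finset.mul_sum, ← Finset.sum_neg_distrib]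
    refine Finset.sum_congr rfl fun i _ => ?_
    linear_combination y i * eb i
  constructor
  · have hM : a x = Matrix.of fun i j => f ^ 2 * a' x i j
        + (-(k₂ - k₃ * t)) * (b x i * b x j) := by
      ext i j
      rw [Matrix.of_apply, ea]; ring
    have hA : form2 (a x) y y = f ^ 2 * (form2 (a' x) y y
        - (k₂ - k₃ * t) / Q * form1 (b' x) y ^ 2) := by
      rw [hM, form2_rankOne]
      have : form1 (b x) y ^ 2 = f ^ 2 * form1 (b' x) y ^ 2 / Q := by
        rw [eq_div_iff hQ.ne', ← hr2]
        linear_combination (√Q * form1 (b x) y - f * form1 (b' x) y) * hB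
      rw [this]
      ring
    rw [alpha_eq, hA, Real.sqrt_mul (by positivity), Real.sqrt_sq hf.le, alpha_sq hp',
      beta_eq_form1]
  · rw [beta_eq_form1, beta_eq_form1, ← Real.sqrt_eq_rpow]
    field_simp
    linear_combination hB

/-- The given formulas express `(a, b)` through the squared norm of `b'`. The rank-one norm formula
identifies it with that of `b`, since `1 - (k₂ - k₃ t) t / Q = 1 / Q` for `Q = 1 + k₂ t - k₃ t²`;
only then can the relation be inverted. -/
theorem isDeformedOn_of_isDeformationOn (hU : IsOpen U) (ha : IsRiemannianMetricOn U a)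
    (hb : IsOneFormOn U b) (ha' : IsRiemannianMetricOn U a') (hb' : IsOneFormOn U b')
    (h : IsDeformationOn k₁ k₂ k₃ U a b a' b') :
    IsDeformedOn k₁ k₂ k₃ (eta k₁ k₂ k₃) U a b a' b' := by
  have key : ∀ x ∈ U, normSq a b x = normSq a' b' x ∧
      (∀ i j, eta k₁ k₂ k₃ (normSq a' b' x) ^ 2 * a' x i j
        = a x i j + (k₂ - k₃ * normSq a' b' x) * (b x i * b x j)) ∧
      ∀ i, eta k₁ k₂ k₃ (normSq a' b' x) * b' x i
        = -(√(deformQ k₂ k₃ (normSq a' b' x)) * b x i) := by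
    intro x hx
    obtain ⟨hd, hxy⟩ := h x hx
    have hf := (isFactorAt_eta (k₁ := k₁) hd).1
    have hQ := hd.1
    have hQd : deformQ k₂ k₃ (normSq a' b' x)
      = 1 + k₂ * normSq a' b' x - k₃ * normSq a' b' x ^ 2 := rfl
    have hp := ha.posDef x hx
    have hp' := ha'.posDef x hx
    have hrank := fun l κ μ => normSq_rankOne (a := a') (a' := a) (b := b') (b' := b) (l := l)
      (κ := κ) (μ := μ) hp' hp
    generalize normSq a' b' x = t at *
    generalize eta k₁ k₂ k₃ t = f at *
    generalize deformQ k₂ k₃ t = Q at *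
    have hr := Real.sqrt_pos.2 hQ
    have hr2 := Real.sq_sqrt hQ.le
    have eb : ∀ i, b x i = -(f / √Q) * b' x i := by
      intro i
      have := (hxy (Pi.single i 1)).2
      rwa [beta_eq_form1, beta_eq_form1, form1_single, form1_single, ← Real.sqrt_eq_rpow] at this
    have hM : a x = Matrix.of fun i j => f ^ 2 * a' x i j
        + (-(f ^ 2 * ((k₂ - k₃ * t) / Q))) * (b' x i * b' x j) := by
      refine form2_ext_of_quadratic (ha.symm hx) (fun i j => ?_) fun y => ?_
      · simp only [Matrix.of_apply, ha'.symm hx i j, mul_comm (b' x i)]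
      · rw [form2_rankOne]
        by_cases hy : y = 0
        · simp [hy]
        have h1 := (hxy y).1
        have h2 : 0 < alpha a x y := by
          rw [alpha_eq]; exact Real.sqrt_pos.2 (posDef_form2_pos hp y hy)
        rw [h1] at h2
        -- As `α > 0` off the zero vector, the radicand is positive and the formula for `α` may be
        -- squared.
        have h3 := Real.sqrt_pos.1 (pos_of_mul_pos_right h2 hf.le)
        rw [← alpha_sq hp, h1, mul_pow, Real.sq_sqrt h3.le, alpha_sq hp', beta_eq_form1]
        ring
    have ea : ∀ i j, a x i j = f ^ 2 * (a' x i j + (-((k₂ - k₃ * t) / Q)) * (b' x i * b' x j)) := by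
      intro i j
      rw [hM, Matrix.of_apply]; ring
    have hκ : 1 + -((k₂ - k₃ * t) / Q) * t = 1 / Q := by
      field_simp
      rw [hQd]; ring
    refine ⟨?_, fun i j => ?_, fun i => ?_⟩
    · rw [hrank _ _ _ ea eb (by positivity) (by rw [hκ]; positivity), hκ, neg_sq, div_pow, hr2]
      field_simp
    · have : b x i * b x j = f ^ 2 / Q * (b' x i * b' x j) := by
        rw [eb, eb, show f ^ 2 / Q = (f / √Q) ^ 2 by rw [div_pow, hr2]]; ring
      rw [this, ea]
      field_simp
      ring
    · rw [eb]; field_simp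
  have ht := fun x hx => (key x hx).1
  refine ⟨hU, ha, hb, ha', hb', fun x hx => ?_, fun x hx => ?_, fun x hx => ?_, fun x hx => ?_⟩
  · rw [ht x hx]; exact isFactorAt_eta (h x hx).1
  · rw [ht x hx]; exact (h x hx).1.1
  · rw [ht x hx]; exact (key x hx).2.1
  · rw [ht x hx]; exact (key x hx).2.2

/-- With `θ` and `c` given by traces, both sides of the jet equations are continuous on `U`. -/
theorem HasDualJetAt.of_mem_closure (hU : IsOpen U) (ha : IsRiemannianMetricOn U a)
    (hb : IsOneFormOn U b) {W : Set (Fin n → ℝ)}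
    (h : ∀ x ∈ W, HasDualJetAt a b x (traceForm a x) (traceScalar a b x)) (hx : x ∈ U)
    (hxW : x ∈ closure W) : HasDualJetAt a b x (traceForm a x) (traceScalar a b x) := by
  have hfr := mem_closure_iff_frequently.1 hxW
  have c0 : ∀ {f : (Fin n → ℝ) → ℝ}, ContDiffOn ℝ ∞ f U → ContinuousAt f x := fun hf =>
    (differentiableAt_of_smoothOn hU hf hx).continuousAt
  have hθ := isOneFormOn_traceForm hU ha
  have sc := smoothOn_traceScalar hU ha hb
  have sa := ha.smooth
  constructor
  · intro i j k
    exact tendsto_nhds_unique_of_frequently_eq (c0 (smoothOn_metricJet hU ha i j k))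
      (c0 (f := fun x => 4 * (traceForm a x i * a x j k + traceForm a x j * a x i k
        + traceForm a x k * a x i j))
        (contDiffOn_const.mul ((((hθ i).mul (sa j k)).add ((hθ j).mul (sa i k))).add
          ((hθ k).mul (sa i j)))))
      (hfr.mono fun y hy => (h y hy).1 i j k)
  · intro i j
    exact tendsto_nhds_unique_of_frequently_eq (c0 (smoothOn_formJet hU hb i j))
      (c0 (f := fun x => 4 * traceForm a x i * b x j + 2 * traceForm a x j * b x i
        + traceScalar a b x * a x i j)
        ((((contDiffOn_const.mul (hθ i)).mul (hb j)).add
          ((contDiffOn_const.mul (hθ j)).mul (hb i))).add (sc.mul (sa i j))))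
      (hfr.mono fun y hy => (h y hy).2 i j)

theorem isDuallyFlatOn_alphaBetaFun_of_isDeformedOn {f : ℝ → ℝ} (hI : IsSymmetricOpenInterval I)
    (hφ : ContDiffOn ℝ ∞ φ I) (hode : SolvesODE k₁ k₂ k₃ I φ)
    (hdom : ∀ x ∈ U, ∀ y, y ≠ 0 → beta b x y / alpha a x y ∈ I)
    (h : IsDeformedOn k₁ k₂ k₃ f U a b a' b') (hr : IsDuallyRelatedOn U a' b') :
    IsDuallyFlatOn U (alphaBetaFun φ a b) := by
  obtain ⟨θ, c, -, -, hj⟩ := (isDuallyRelatedOn_iff h.isOpen h.metric' h.form').1 hr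
  intro x hx y hy l
  obtain ⟨θ', m, hjet⟩ := h.exists_hasFlatJet hx (hj x hx)
  rw [duallyFlat_eq_flatExpr h.isOpen h.metric h.form hI.isOpen hφ hx (hdom x hx) hy]
  exact flatExpr_eq_zero_of_hasFlatJet h.metric hode hx (hdom x hx) hjet hy _

/-- Off the zeros of `b'` the pointwise algebra gives the jet. Every other point of `U` is a limit
of such points: otherwise unique continuation would make `b` vanish on a whole component, where `F`
would be `φ(0) α`. -/
theorem IsDeformedOn.hasDualJetAt_trace {f : ℝ → ℝ} (hn : 2 ≤ n)
    (hI : IsSymmetricOpenInterval I) (hφ : ContDiffOn ℝ ∞ φ I) (hφpos : ∀ s ∈ I, 0 < φ s)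
    (hφ0 : deriv φ 0 ≠ 0) (hode : SolvesODE k₁ k₂ k₃ I φ)
    (hdom : ∀ x ∈ U, ∀ y, y ≠ 0 → beta b x y / alpha a x y ∈ I)
    (hnonRiem : ∀ x ∈ U, ¬ IsRiemannianOn (connectedComponentIn U x) (alphaBetaFun φ a b))
    (h : IsDeformedOn k₁ k₂ k₃ f U a b a' b')
    (hflat : IsDuallyFlatOn U (alphaBetaFun φ a b)) (hx : x ∈ U) :
    HasDualJetAt a' b' x (traceForm a' x) (traceScalar a' b' x) := by
  have hU := h.isOpen
  have hzero : ∀ x ∈ U, b' x = 0 ↔ b x = 0 := by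
    intro x hx
    have hf := (h.factor x hx).1
    have hr := Real.sqrt_pos.2 (h.pos x hx)
    constructor
    · intro h0
      ext i
      have := h.form_eq x hx i
      rw [h0] at this
      simpa [hr.ne'] using this
    · intro h0
      ext i
      have := h.form_eq x hx i
      rw [h0] at this
      simpa [hf.ne'] using this
  have hjet : ∀ x ∈ U, b' x ≠ 0 →
      HasDualJetAt a' b' x (traceForm a' x) (traceScalar a' b' x) := by
    intro x hx hbx
    obtain ⟨θ, m, hj⟩ := exists_hasFlatJet_of_flatExpr hn hU h.metric hI hφ hφpos hφ0 hode hx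
      (hdom x hx) (fun h0 => hbx ((hzero x hx).2 h0)) (h.pos x hx) fun y hy l => by
        rw [← duallyFlat_eq_flatExpr hU h.metric h.form hI.isOpen hφ hx (hdom x hx) hy]
        exact hflat x hx y hy l
    obtain ⟨θ', c, hd⟩ := h.hasDualJetAt hx hj
    have hp := h.metric'.posDef x hx
    rw [hd.eq_traceForm hp, hd.eq_traceScalar (by omega) hp]
    exact hd
  by_cases hcl : x ∈ closure {x | x ∈ U ∧ b' x ≠ 0}
  · exact HasDualJetAt.of_mem_closure hU h.metric' h.form'
      (fun y hy => hjet y hy.1 hy.2) hx hcl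
  · exfalso
    have h0 := form_eq_zero_of_hasDualJetAt hn hU h.metric' h.form' hjet hx hcl
    have hsub := connectedComponentIn_subset U x
    exact hnonRiem x hx (isRiemannianOn_of_form_eq_zero
      ⟨fun i j => (h.metric.smooth i j).mono hsub, fun y hy => h.metric.posDef y (hsub hy)⟩
      (hφpos 0 hI.zero_mem) fun y hy => (hzero y (hsub hy)).1 (h0 y hy))

end MainTheorem

end AlphaBeta

end

theorem theorem1p2 {n : ℕ} (hn : 3 ≤ n) (U : Set (Fin n → ℝ)) (hU : IsOpen U)
    (k₁ k₂ k₃ : ℝ)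
    (I : Set ℝ) (hI : AlphaBeta.IsSymmetricOpenInterval I)
    (φ : ℝ → ℝ) (hφ : ContDiffOn ℝ ∞ φ I) (hφpos : ∀ s ∈ I, 0 < φ s)
    (hφ0 : deriv φ 0 ≠ 0) (hode : AlphaBeta.SolvesODE k₁ k₂ k₃ I φ)
    (a : (Fin n → ℝ) → Matrix (Fin n) (Fin n) ℝ) (ha : AlphaBeta.IsRiemannianMetricOn U a)
    (b : (Fin n → ℝ) → Fin n → ℝ) (hb : AlphaBeta.IsOneFormOn U b)
    (hdom : ∀ x ∈ U, ∀ y, y ≠ 0 → AlphaBeta.beta b x y / AlphaBeta.alpha a x y ∈ I)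
    (hF : AlphaBeta.IsFinslerMetricOn U (AlphaBeta.alphaBetaFun φ a b))
    (hnonRiem : ∀ x ∈ U,
      ¬ AlphaBeta.IsRiemannianOn (connectedComponentIn U x) (AlphaBeta.alphaBetaFun φ a b))
    (hadm : ∀ x ∈ U, AlphaBeta.Admissible k₂ k₃ (AlphaBeta.normSq a b x)) :
    AlphaBeta.IsDuallyFlatOn U (AlphaBeta.alphaBetaFun φ a b) ↔
      ∃ (a' : (Fin n → ℝ) → Matrix (Fin n) (Fin n) ℝ) (b' : (Fin n → ℝ) → Fin n → ℝ),
        AlphaBeta.IsRiemannianMetricOn U a' ∧ AlphaBeta.IsOneFormOn U b' ∧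
        AlphaBeta.IsDuallyFlatOn U (AlphaBeta.alpha a') ∧
        AlphaBeta.IsDuallyRelatedOn U a' b' ∧
        AlphaBeta.IsDeformationOn k₁ k₂ k₃ U a b a' b' := by
  constructor
  · intro hflat
    obtain ⟨a', b', h⟩ := AlphaBeta.exists_isDeformedOn hU ha hb
      (fun x hx => AlphaBeta.isFactorAt_eta (k₁ := k₁) (hadm x hx)) (fun x hx => (hadm x hx).1)
    have hjet := fun x (hx : x ∈ U) => h.hasDualJetAt_trace (by omega) hI hφ hφpos hφ0 hode hdom
      hnonRiem hflat hx
    refine ⟨a', b', h.metric', h.form', ?_, ?_, h.isDeformationOn hadm⟩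
    · refine AlphaBeta.isDuallyFlatOn_alpha hU h.metric' fun x hx i j k => ?_
      rw [(hjet x hx).1, (hjet x hx).1, h.metric'.symm hx k j, h.metric'.symm hx k i,
        h.metric'.symm hx j i]
      ring
    · exact (AlphaBeta.isDuallyRelatedOn_iff hU h.metric' h.form').2
        ⟨_, _, AlphaBeta.isOneFormOn_traceForm hU h.metric',
          AlphaBeta.smoothOn_traceScalar hU h.metric' h.form', hjet⟩
  · rintro ⟨a', b', ha', hb', -, hrel, hdef⟩
    exact AlphaBeta.isDuallyFlatOn_alphaBetaFun_of_isDeformedOn hI hφ hode hdom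
      (AlphaBeta.isDeformedOn_of_isDeformationOn hU ha hb ha' hb' hdef) hrel
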